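/- Let $n\ge 0$ and let $M$ be a connected smooth manifold (Hausdorff, second countable) of dimension $2n+1$ with a paracontact metric structure $(\varphi,\xi,\eta,g)$: $\eta$ is a smooth $1$-form with $\eta\wedge(d\eta)^n\neq 0$ everywhere, $\xi$ is its Reeb vector field ($\eta(\xi)=1$, $d\eta(\xi,\cdot)=0$), $g$ is a smooth semi-Riemannian metric and $\varphi$ a smooth tensor field of type $(1,1)$ such that $$\eta=g(\xi,\cdot),\qquad d\eta(\cdot,\cdot)=g(\cdot,\varphi\,\cdot),\qquad \varphi^2=I-\eta\otimes\xi,$$ where $2\,d\eta(X,Y)=X(\eta(Y))-Y(\eta(X))-\eta([X,Y])$. Let $Q$ be the Ricci operator of $g$, and suppose that $(M,\varphi,\xi,\eta,g)$ is $\eta$-Einstein, that is, there are smooth functions $a,b$ on $M$ with $$Q=a\,I+b\,\eta\otimes\xi .$$ Then $(M,\varphi,\xi,\eta,g)$ is $H$-paracontact, that is, $\xi$ is a harmonic vector field. Here a smooth vector field $V$ with $g(V,V)=r$ for a constant $r\neq0$ is called harmonic if it is a critical point of the energy among the vector fields of the same length: for every relatively compact open set $D\subseteq M$ and every smooth variation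 $(V_t)_{|t|<\varepsilon}$ of $V=V_0$ through smooth vector fields with $g(V_t,V_t)=r$ that agree with $V$ outside of a compact subset of $D$ not depending on $t$, one has $$\frac{d}{dt}\Big|_{t=0}E_D(V_t)=0,\qquad E_D(V)=\frac12\int_D \operatorname{tr}_g(V^*g^s)\,dv_g,$$ where $g^s$ is the Sasaki metric on $TM$, so that $(V^*g^s)(X,Y)=g(X,Y)+g(\nabla_XV,\nabla_YV)$ with the Levi-Civita connection $\nabla$ of $g$. -/

import Mathlib

open Bundle MeasureTheory
open scoped Manifold ContDiff Topology

noncomputable section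

namespace Paracontact

section SemiRiemannian

variable {m : ℕ} {M : Type*} [TopologicalSpace M] [ChartedSpace (EuclideanSpace ℝ (Fin m)) M]

/-- A (not necessarily continuous) vector field on the `m`-dimensional manifold `M`. -/
abbrev VField (m : ℕ) (M : Type*) [TopologicalSpace M]
    [ChartedSpace (EuclideanSpace ℝ (Fin m)) M] : Type _ :=
  (x : M) → TangentSpace (𝓡 m) x

/-- `V` is a smooth vector field. -/
def SmoothVField [IsManifold (𝓡 m) ∞ M] (V : VField m M) : Prop :=
  ContMDiff (𝓡 m) (𝓡 m).tangent ∞ (fun x ↦ (⟨x, V x⟩ : TangentBundle (𝓡 m) M))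

/-- An extension of a tangent vector at `x` to a vector field, smooth near `x` (it is constant in
the chart at `x`). It is used to evaluate tensors that are defined by formulas on vector fields. -/
def ext {x : M} [IsManifold (𝓡 m) ∞ M] (v : TangentSpace (𝓡 m) x) : VField m M :=
  FiberBundle.extend (EuclideanSpace ℝ (Fin m)) v

/-- The Lie bracket of vector fields. -/
def bracket (X Y : VField m M) : VField m M := VectorField.mlieBracket (𝓡 m) X Y

/-- `dirDeriv f x u` is the derivative `u(f)` of the function `f` in the direction of the tangent
vector `u` at `x`. -/
def dirDeriv (f : M → ℝ) (x : M) (u : TangentSpace (𝓡 m) x) : ℝ := mvfderiv (𝓡 m) f x u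

/-- A basis of the tangent space at `x`. -/
def tangentBasis (x : M) : Module.Basis (Fin m) ℝ (TangentSpace (𝓡 m) x) :=
  (EuclideanSpace.basisFun (Fin m) ℝ).toBasis

variable (m M) in
/-- A smooth semi-Riemannian metric: a smooth field of nondegenerate symmetric bilinear forms on
the tangent spaces. (On a connected manifold its index is automatically constant.) -/
structure SemiRiemannianMetric [IsManifold (𝓡 m) ∞ M] where
  /-- The scalar product on the tangent space at `x`. -/
  val : (x : M) → TangentSpace (𝓡 m) x →L[ℝ] TangentSpace (𝓡 m) x →L[ℝ] ℝ
  symm : ∀ x u v, val x u v = val x v u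
  nondegenerate : ∀ x u, (∀ v, val x u v = 0) → u = 0
  contMDiff :
    ContMDiff (𝓡 m) ((𝓡 m).prod 𝓘(ℝ, EuclideanSpace ℝ (Fin m) →L[ℝ]
      EuclideanSpace ℝ (Fin m) →L[ℝ] ℝ)) ∞
      (fun x ↦ TotalSpace.mk' (EuclideanSpace ℝ (Fin m) →L[ℝ] EuclideanSpace ℝ (Fin m) →L[ℝ] ℝ)
        (E := fun x : M ↦ TangentSpace (𝓡 m) x →L[ℝ] TangentSpace (𝓡 m) x →L[ℝ] ℝ) x (val x))

namespace SemiRiemannianMetric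

variable [IsManifold (𝓡 m) ∞ M] (g : SemiRiemannianMetric m M)

/-- The metric at `x` as a bilinear form. -/
def bilin (x : M) : LinearMap.BilinForm ℝ (TangentSpace (𝓡 m) x) := (g.val x).toBilinForm

theorem bilin_nondegenerate (x : M) : (g.bilin x).Nondegenerate :=
  ⟨fun u h ↦ g.nondegenerate x u h,
    fun u h ↦ g.nondegenerate x u fun v ↦ (g.symm x u v).trans (h v)⟩

/-- The basis `eⁱ` of the tangent space at `x` with `g(eⁱ, eⱼ) = δᵢⱼ`, where `eⱼ` is
`tangentBasis x`. The vector `u` with `g(u, eᵢ) = λᵢ` is `∑ i, λᵢ eⁱ`, and the metric trace of a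
bilinear form `T` is `∑ i, T(eᵢ, eⁱ)`, which is `∑ i, εᵢ T(Eᵢ, Eᵢ)` for a pseudo-orthonormal
basis `E`. -/
def dualBasis (x : M) : Module.Basis (Fin m) ℝ (TangentSpace (𝓡 m) x) :=
  (g.bilin x).dualBasis (g.bilin_nondegenerate x) (tangentBasis x)

/-- The right-hand side of the Koszul formula for `2 g(∇_X Y, Z)`. -/
def koszul (X Y Z : VField m M) (x : M) : ℝ :=
  dirDeriv (fun y ↦ g.val y (Y y) (Z y)) x (X x)
    + dirDeriv (fun y ↦ g.val y (X y) (Z y)) x (Y x)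
    - dirDeriv (fun y ↦ g.val y (X y) (Y y)) x (Z x)
    + g.val x (bracket X Y x) (Z x)
    - g.val x (bracket X Z x) (Y x)
    - g.val x (bracket Y Z x) (X x)

/-- The Levi-Civita connection: `g.nabla Y x u` is `∇_u Y` for a vector field `Y` (differentiable
at `x`) and a tangent vector `u` at `x`. It is the tangent vector determined by the Koszul
formula. -/
def nabla (Y : VField m M) (x : M) (u : TangentSpace (𝓡 m) x) : TangentSpace (𝓡 m) x :=
  ∑ i, (1 / 2 * g.koszul (ext u) Y (ext (tangentBasis x i)) x) • g.dualBasis x i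

/-- The vector field `∇_X Y`. -/
def nablaField (X Y : VField m M) : VField m M := fun x ↦ g.nabla Y x (X x)

/-- The curvature tensor `R(u, v) w`, with the sign convention
`R_{XY} = ∇_{[X,Y]} - [∇_X, ∇_Y]`. -/
def curvature (x : M) (u v w : TangentSpace (𝓡 m) x) : TangentSpace (𝓡 m) x :=
  g.nabla (ext w) x (bracket (ext u) (ext v) x)
    - (g.nablaField (ext u) (g.nablaField (ext v) (ext w)) x
      - g.nablaField (ext v) (g.nablaField (ext u) (ext w)) x)

/-- The Ricci tensor of type `(0,2)`: the metric trace of `(v, v') ↦ g(R(u, v) w, v')`. -/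
def ricci (x : M) (u w : TangentSpace (𝓡 m) x) : ℝ :=
  ∑ i, g.val x (g.curvature x u (tangentBasis x i) w) (g.dualBasis x i)

/-- The Ricci operator `Q`, given by `g(Q u, w) = ϱ(u, w)`. -/
def ricciOp (x : M) (u : TangentSpace (𝓡 m) x) : TangentSpace (𝓡 m) x :=
  ∑ i, g.ricci x u (tangentBasis x i) • g.dualBasis x i

/-- The matrix entry `g(∂ᵢ, ∂ⱼ)` of the metric in the coordinates of the chart at `p`, at the point
with coordinates `y`. -/
def coordMetric (p : M) (y : EuclideanSpace ℝ (Fin m)) : Matrix (Fin m) (Fin m) ℝ :=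
  Matrix.of fun i j ↦
    let d (k : Fin m) : TangentSpace (𝓡 m) ((extChartAt (𝓡 m) p).symm y) :=
      mfderiv 𝓘(ℝ, EuclideanSpace ℝ (Fin m)) (𝓡 m) (extChartAt (𝓡 m) p).symm y
        (EuclideanSpace.single k 1 : EuclideanSpace ℝ (Fin m))
    g.val _ (d i) (d j)

/-- The measure `√|det (gᵢⱼ)| dy¹ ⋯ dyᵐ` on the domain of the chart at `p` (and zero outside of
that domain). -/
def chartVolume [MeasurableSpace M] (p : M) : Measure M :=
  (((volume : Measure (EuclideanSpace ℝ (Fin m))).restrict (extChartAt (𝓡 m) p).target).withDensity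
    fun y ↦ ENNReal.ofReal (√|(g.coordMetric p y).det|)).map (extChartAt (𝓡 m) p).symm

/-- The volume measure of the metric. The chart measures agree on the overlaps of the chart
domains, so that their supremum is the measure that restricts to each of them. -/
def volumeMeasure [MeasurableSpace M] : Measure M := ⨆ p : M, g.chartVolume p

/-- The pull-back `V^* gˢ` of the Sasaki metric under a vector field `V : M → TM`. As `dV(u)` has
the horizontal part `u` and the vertical part `∇_u V`, it is
`(V^* gˢ)(u, v) = g(u, v) + g(∇_u V, ∇_v V)`. -/
def sasakiPullback (V : VField m M) (x : M) (u v : TangentSpace (𝓡 m) x) : ℝ :=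
  g.val x u v + g.val x (g.nabla V x u) (g.nabla V x v)

/-- The energy density `½ tr_g (V^* gˢ)`. -/
def energyDensity (V : VField m M) (x : M) : ℝ :=
  1 / 2 * ∑ i, g.sasakiPullback V x (tangentBasis x i) (g.dualBasis x i)

/-- The energy of the vector field `V` over `D`. -/
def energy [MeasurableSpace M] (D : Set M) (V : VField m M) : ℝ :=
  ∫ x in D, g.energyDensity V x ∂g.volumeMeasure

/-- The set of smooth vector fields of constant square length `r`. -/
def constLengthFields (r : ℝ) : Set (VField m M) :=
  {V | SmoothVField V ∧ ∀ x, g.val x (V x) (V x) = r}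

/-- `W` is a smooth variation of `V`, with parameter `t ∈ (-ε, ε)`, through vector fields of
constant square length `r`, and it is constant outside of a compact subset of `D`. -/
structure IsVariation (r : ℝ) (V : VField m M) (D : Set M) (ε : ℝ) (W : ℝ → VField m M) :
    Prop where
  pos : 0 < ε
  smooth : ContMDiffOn (𝓘(ℝ, ℝ).prod (𝓡 m)) (𝓡 m).tangent ∞
    (fun p : ℝ × M ↦ (⟨p.2, W p.1 p.2⟩ : TangentBundle (𝓡 m) M)) (Set.Ioo (-ε) ε ×ˢ Set.univ)
  zero : W 0 = V
  mem : ∀ t ∈ Set.Ioo (-ε) ε, W t ∈ g.constLengthFields r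
  support : ∃ K : Set M, IsCompact K ∧ K ⊆ D ∧ ∀ t ∈ Set.Ioo (-ε) ε, ∀ x ∉ K, W t x = V x

/-- `V` is a harmonic vector field: it has constant square length `r ≠ 0`, and it is a critical
point of the energy, restricted to the vector fields of the same length. The energy is taken over
relatively compact open sets `D` (for compact `M` this includes `D = M`). -/
def IsHarmonicVField [MeasurableSpace M] (V : VField m M) : Prop :=
  ∃ r : ℝ, r ≠ 0 ∧ V ∈ g.constLengthFields r ∧
    ∀ D : Set M, IsOpen D → IsCompact (closure D) → ∀ (ε : ℝ) (W : ℝ → VField m M),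
      g.IsVariation r V D ε W → HasDerivAt (fun t ↦ g.energy D (W t)) 0 0

end SemiRiemannianMetric

/-- The exterior derivative of a 1-form, with the convention
`2 dη(X, Y) = X(η(Y)) - Y(η(X)) - η([X, Y])`. -/
def extDeriv₁ [IsManifold (𝓡 m) ∞ M] (η : (x : M) → TangentSpace (𝓡 m) x →L[ℝ] ℝ) (x : M)
    (u v : TangentSpace (𝓡 m) x) : ℝ :=
  1 / 2 * (dirDeriv (fun y ↦ η y (ext v y)) x u - dirDeriv (fun y ↦ η y (ext u y)) x v
    - η x (bracket (ext u) (ext v) x))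

end SemiRiemannian

section Structures

variable {n : ℕ} {M : Type*} [TopologicalSpace M]
  [ChartedSpace (EuclideanSpace ℝ (Fin (2 * n + 1))) M] [IsManifold (𝓡 (2 * n + 1)) ∞ M]

/-- The value of `η ∧ (dη)ⁿ` on the vectors `v₀, …, v₂ₙ` at `x`, up to a positive constant factor
that depends only on `n`. -/
def contactVolume (η : (x : M) → TangentSpace (𝓡 (2 * n + 1)) x →L[ℝ] ℝ) (x : M)
    (v : Fin (2 * n + 1) → TangentSpace (𝓡 (2 * n + 1)) x) : ℝ :=
  ∑ σ : Equiv.Perm (Fin (2 * n + 1)), ((Equiv.Perm.sign σ : ℤ) : ℝ) *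
    (η x (v (σ 0)) * ∏ i : Fin n, extDeriv₁ η x (v (σ ⟨2 * i.val + 1, by omega⟩))
      (v (σ ⟨2 * i.val + 2, by omega⟩)))

variable (n M) in
/-- A paracontact metric structure `(φ, ξ, η, g)` on the `(2n+1)`-dimensional manifold `M`. -/
structure ParacontactMetricStructure where
  /-- The associated metric. -/
  g : SemiRiemannianMetric (2 * n + 1) M
  /-- The contact form. -/
  η : (x : M) → TangentSpace (𝓡 (2 * n + 1)) x →L[ℝ] ℝ
  /-- The Reeb vector field. -/
  ξ : VField (2 * n + 1) M
  /-- The structure tensor of type `(1,1)`. -/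
  φ : (x : M) → TangentSpace (𝓡 (2 * n + 1)) x →L[ℝ] TangentSpace (𝓡 (2 * n + 1)) x
  smooth_η : ContMDiff (𝓡 (2 * n + 1))
    ((𝓡 (2 * n + 1)).prod 𝓘(ℝ, EuclideanSpace ℝ (Fin (2 * n + 1)) →L[ℝ] ℝ)) ∞
    (fun x ↦ TotalSpace.mk' (EuclideanSpace ℝ (Fin (2 * n + 1)) →L[ℝ] ℝ)
      (E := fun x : M ↦ TangentSpace (𝓡 (2 * n + 1)) x →L[ℝ] ℝ) x (η x))
  smooth_ξ : SmoothVField ξ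
  smooth_φ : ContMDiff (𝓡 (2 * n + 1))
    ((𝓡 (2 * n + 1)).prod 𝓘(ℝ, EuclideanSpace ℝ (Fin (2 * n + 1)) →L[ℝ]
      EuclideanSpace ℝ (Fin (2 * n + 1)))) ∞
    (fun x ↦ TotalSpace.mk'
      (EuclideanSpace ℝ (Fin (2 * n + 1)) →L[ℝ] EuclideanSpace ℝ (Fin (2 * n + 1)))
      (E := fun x : M ↦ TangentSpace (𝓡 (2 * n + 1)) x →L[ℝ] TangentSpace (𝓡 (2 * n + 1)) x)
      x (φ x))
  /-- `η ∧ (dη)ⁿ` vanishes nowhere. -/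
  contact : ∀ x, ∃ v, contactVolume η x v ≠ 0
  η_ξ : ∀ x, η x (ξ x) = 1
  dη_ξ : ∀ x u, extDeriv₁ η x (ξ x) u = 0
  η_eq : ∀ x u, η x u = g.val x (ξ x) u
  dη_eq : ∀ x u v, extDeriv₁ η x u v = g.val x u (φ x v)
  φ_sq : ∀ x u, φ x (φ x u) = u - η x u • ξ x

namespace ParacontactMetricStructure

variable (S : ParacontactMetricStructure n M)

/-- `Q = a I + b η ⊗ ξ` for smooth functions `a` and `b`. -/
def IsEtaEinstein : Prop :=
  ∃ a b : M → ℝ, ContMDiff (𝓡 (2 * n + 1)) 𝓘(ℝ, ℝ) ∞ a ∧ ContMDiff (𝓡 (2 * n + 1)) 𝓘(ℝ, ℝ) ∞ b ∧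
    ∀ x u, S.g.ricciOp x u = a x • u + (b x * S.η x u) • S.ξ x

/-- The Reeb vector field is a harmonic vector field. -/
def IsHParacontact [MeasurableSpace M] : Prop := S.g.IsHarmonicVField S.ξ

end ParacontactMetricStructure

end Structures

end Paracontact

end

/-! Along a variation of ξ through unit fields, the variation field Y is orthogonal to ξ and
compactly supported, and the energy has derivative ∫ tr g(∇ξ, ∇Y) at t = 0 (`hasDerivAt_energy`).
Put A = ∇ξ and let X be the field with g(X, ·) = g(Y, A ·). Then div X = tr g(∇ξ, ∇Y) + g(Y, tr
∇²ξ), so by the divergence theorem the integral vanishes once the rough Laplacian tr ∇²ξ has no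
component orthogonal to ξ.

This last claim is pointwise algebra (`ParacontactAt`). Write P = ∇φ and B = ∇²ξ. The relation dη =
g(·, φ ·) makes -φ the skew part of A, hence -P_w the skew part of B_w. For w ⊥ ξ this gives g(tr B,
w) = tr(u ↦ B_u w) - 2 g(w, div φ), and the Ricci identity turns the trace into ϱ(w, ξ) + tr B_w,
where tr B_w is the derivative of div ξ along w. Closedness of dη together with φ² = I - η ⊗ ξ
forces div ξ = 0 and makes div φ a multiple of ξ (`trace_A`, `sum_P`). Only ϱ(w, ξ) = g(Qw, ξ) = a
g(w, ξ) = 0 is left.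

The calculus is done with Christoffel symbols on an open subset of a vector space and carried to the
manifold by charts; `IsDualPair.trace_eq` reconciles the bases of the definitions with coordinate
bases. In a chart the volume measure has the metric density (`volumeMeasure_restrict`), and a
partition of unity reduces the integral to single charts. -/

noncomputable section

namespace Paracontact

/-! ### Pointwise linear algebra: metric traces and the identities for ∇ξ and ∇φ. -/

section DualPair

variable {E : Type*} [NormedAddCommGroup E] [NormedSpace ℝ E]
  {ι κ : Type*} [Fintype ι] [Fintype κ]

/-- Two finite families of vectors that are dual to each other with respect to the bilinear
form `G`. -/
structure IsDualPair (G : E →L[ℝ] E →L[ℝ] ℝ) (b c : ι → E) : Prop where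
  left : ∀ v, ∑ i, G v (c i) • b i = v
  right : ∀ v, ∑ i, G v (b i) • c i = v

/-- A function of two variables that is linear in each of them. -/
structure IsBilin (f : E → E → ℝ) : Prop where
  fst : ∀ v, IsLinearMap ℝ fun u ↦ f u v
  snd : ∀ u, IsLinearMap ℝ (f u)

theorem IsBilin.sum_fst {f : E → E → ℝ} (hf : IsBilin f) (a : ι → ℝ) (b : ι → E) (v : E) :
    f (∑ i, a i • b i) v = ∑ i, a i * f (b i) v := by
  have := map_sum ((hf.fst v).mk' _) (fun i ↦ a i • b i) Finset.univ
  simp only [IsLinearMap.mk'_apply, (hf.fst v).map_smul, smul_eq_mul] at this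
  exact this

theorem IsBilin.sum_snd {f : E → E → ℝ} (hf : IsBilin f) (a : ι → ℝ) (b : ι → E) (u : E) :
    f u (∑ i, a i • b i) = ∑ i, a i * f u (b i) := by
  have := map_sum ((hf.snd u).mk' _) (fun i ↦ a i • b i) Finset.univ
  simp only [IsLinearMap.mk'_apply, (hf.snd u).map_smul, smul_eq_mul] at this
  exact this

theorem isBilin_clm (β : E →L[ℝ] E →L[ℝ] ℝ) : IsBilin fun u v ↦ β u v :=
  ⟨fun v ↦ ⟨by simp, by simp⟩, fun u ↦ ⟨by simp, by simp⟩⟩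

variable {G : E →L[ℝ] E →L[ℝ] ℝ}

theorem IsDualPair.swap {b c : ι → E} (h : IsDualPair G b c) : IsDualPair G c b :=
  ⟨h.right, h.left⟩

/-- Expanding `b i` in the second pair and then resumming over `i` in the first exchanges the two
pairs. Hence the metric trace of a bilinear form does not depend on the dual pair. -/
theorem IsDualPair.trace_eq (hG : ∀ u v, G u v = G v u) {b c : ι → E} {b' c' : κ → E}
    (h : IsDualPair G b c) (h' : IsDualPair G b' c') {f : E → E → ℝ} (hf : IsBilin f) :
    ∑ i, f (b i) (c i) = ∑ j, f (b' j) (c' j) := by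
  calc ∑ i, f (b i) (c i) = ∑ i, f (∑ j, G (b i) (c' j) • b' j) (c i) := by simp_rw [h'.left]
    _ = ∑ i, ∑ j, G (b i) (c' j) * f (b' j) (c i) := by simp_rw [hf.sum_fst]
    _ = ∑ j, ∑ i, G (c' j) (b i) * f (b' j) (c i) := by
      rw [Finset.sum_comm]; simp_rw [hG (b _) (c' _)]
    _ = ∑ j, f (b' j) (c' j) := by simp_rw [← hf.sum_snd, h.right]

theorem IsDualPair.trace_swap (hG : ∀ u v, G u v = G v u) {b c : ι → E}
    (h : IsDualPair G b c) {f : E → E → ℝ} (hf : IsBilin f) :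
    ∑ i, f (c i) (b i) = ∑ i, f (b i) (c i) :=
  h.swap.trace_eq hG h hf

theorem IsDualPair.trace_skew {b c : ι → E}
    (h : IsDualPair G b c) {f : E → E → ℝ} (hf : IsBilin f) {T : E → E}
    (hT : ∀ u v, G (T u) v = - G (T v) u) :
    ∑ i, f (T (b i)) (c i) = - ∑ i, f (b i) (T (c i)) := by
  calc ∑ i, f (T (b i)) (c i) = ∑ i, f (∑ j, G (T (b i)) (c j) • b j) (c i) := by
        simp_rw [h.left]
    _ = ∑ i, ∑ j, G (T (b i)) (c j) * f (b j) (c i) := by simp_rw [hf.sum_fst]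
    _ = - ∑ j, ∑ i, G (T (c j)) (b i) * f (b j) (c i) := by
      rw [Finset.sum_comm]; simp_rw [hT (b _) (c _)]; simp
    _ = - ∑ j, f (b j) (T (c j)) := by simp_rw [← hf.sum_snd, h.right]

/-- The pointwise identities satisfied by `A = ∇ξ`, `P = ∇φ` for a paracontact metric structure. -/
structure ParacontactAt (G : E →L[ℝ] E →L[ℝ] ℝ) (ξ : E) (φ A : E →L[ℝ] E)
    (P : E →L[ℝ] E →L[ℝ] E) : Prop where
  symm : ∀ u v, G u v = G v u
  φ_skew : ∀ u v, G u (φ v) = - G v (φ u)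
  η_φ : ∀ u, G ξ (φ u) = 0
  φ_sq : ∀ u, φ (φ u) = u - G ξ u • ξ
  ξ_ξ : G ξ ξ = 1
  A_ξ : A ξ = 0
  ξ_A : ∀ u, G (A u) ξ = 0
  P_skew : ∀ w u v, G u (P w v) = - G v (P w u)
  P_cyclic : ∀ u v w, G v (P u w) + G w (P v u) + G u (P w v) = 0
  P_φ : ∀ w u, P w (φ u) + φ (P w u) = - (G (A w) u • ξ + G ξ u • A w)

namespace ParacontactAt

variable {ξ : E} {φ A : E →L[ℝ] E} {P : E →L[ℝ] E →L[ℝ] E} (h : ParacontactAt G ξ φ A P)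
  {b c : ι → E} (hbc : IsDualPair G b c)
include h hbc

/-- Call the sum S and trace `P_cyclic` at `b i`, `φ (c i)`, `w`. The first term gives -S since P is
skew, the second gives -S by moving φ across the trace, and the third is the trace of P_w φ. That
trace vanishes: φ and P_w anticommute up to g(A w, ·) ξ + η ⊗ A w, which is traceless because A w ⊥
ξ. So -2S = 0. -/
theorem sum_P_φ (w : E) : ∑ i, G w (P (b i) (φ (c i))) = 0 := by
  have hf : IsBilin fun u v ↦ G w (P u v) := ⟨fun v ↦ ⟨by simp, by simp⟩, fun u ↦ ⟨by simp, by simp⟩⟩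
  have hf' : IsBilin fun u v ↦ G w (P u (φ v)) :=
    ⟨fun v ↦ ⟨by simp, by simp⟩, fun u ↦ ⟨by simp, by simp⟩⟩
  have hf3 : IsBilin fun u v ↦ G u (P w (φ v)) :=
    ⟨fun v ↦ ⟨by simp, by simp⟩, fun u ↦ ⟨by simp, by simp⟩⟩
  have hT : ∀ u v, G (φ u) v = - G (φ v) u := fun u v ↦ by
    rw [h.symm, h.φ_skew, h.symm]
  have h1 : ∑ i, G (φ (c i)) (P (b i) w) = - ∑ i, G w (P (b i) (φ (c i))) := by
    rw [← Finset.sum_neg_distrib]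
    exact Finset.sum_congr rfl fun i _ ↦ h.P_skew _ _ _
  have h2 : ∑ i, G w (P (φ (c i)) (b i)) = - ∑ i, G w (P (b i) (φ (c i))) := by
    rw [hbc.swap.trace_skew hf hT, hbc.trace_swap h.symm hf']
  have hc1 : ∑ i, G (A w) (c i) * G (b i) ξ = 0 := by
    have := (isBilin_clm G).sum_fst (fun i ↦ G (A w) (c i)) b ξ
    rw [← this, hbc.left, h.ξ_A]
  have hc2 : ∑ i, G ξ (c i) * G (b i) (A w) = 0 := by
    have := (isBilin_clm G).sum_fst (fun i ↦ G ξ (c i)) b (A w)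
    rw [← this, hbc.left, h.symm, h.ξ_A]
  -- By `P_φ` and the skewness of φ and P_w, this trace equals its own negative.
  have h3 : ∑ i, G (b i) (P w (φ (c i))) = - ∑ i, G (b i) (P w (φ (c i))) := by
    calc ∑ i, G (b i) (P w (φ (c i)))
        = ∑ i, (- G (c i) (P w (φ (b i))) -
            (G (A w) (c i) * G (b i) ξ + G ξ (c i) * G (b i) (A w))) := by
          refine Finset.sum_congr rfl fun i _ ↦ ?_
          have e := congrArg (G (b i)) (h.P_φ w (c i))
          simp only [map_add, map_neg, map_smul, smul_eq_mul] at e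
          have e2 := h.φ_skew (b i) (P w (c i))
          have e3 := h.P_skew w (c i) (φ (b i))
          have e4 := h.symm (P w (c i)) (φ (b i))
          linarith
      _ = - ∑ i, G (b i) (P w (φ (c i))) := by
          rw [Finset.sum_sub_distrib, Finset.sum_add_distrib, hc1, hc2, Finset.sum_neg_distrib,
            hbc.trace_swap h.symm hf3]
          ring
  have h4 : ∑ i, (G (φ (c i)) (P (b i) w) + G w (P (φ (c i)) (b i)) + G (b i) (P w (φ (c i)))) = 0 :=
    Finset.sum_eq_zero fun i _ ↦ h.P_cyclic _ _ _
  rw [Finset.sum_add_distrib, Finset.sum_add_distrib, h1, h2] at h4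
  linarith

/-- The trace of `P_φ`: `sum_P_φ` removes one term on the left, and η ⊗ A sums to A ξ = 0 on the
right. -/
theorem sum_φ_P (w : E) :
    ∑ i, G w (φ (P (b i) (c i))) = - ((∑ i, G (A (b i)) (c i)) * G w ξ) := by
  have hc : ∑ i, G ξ (c i) * G w (A (b i)) = 0 := by
    have hf : IsBilin fun u v ↦ G u (A v) := ⟨fun v ↦ ⟨by simp, by simp⟩, fun u ↦ ⟨by simp, by simp⟩⟩
    rw [← hf.sum_snd, hbc.left, h.A_ξ, map_zero]
  have e : ∑ i, (G w (P (b i) (φ (c i))) + G w (φ (P (b i) (c i)))) =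
      ∑ i, - (G (A (b i)) (c i) * G w ξ + G ξ (c i) * G w (A (b i))) := by
    refine Finset.sum_congr rfl fun i _ ↦ ?_
    have e := congrArg (G w) (h.P_φ (b i) (c i))
    simpa only [map_add, map_neg, map_smul, smul_eq_mul] using e
  rw [Finset.sum_add_distrib, h.sum_P_φ hbc, Finset.sum_neg_distrib, Finset.sum_add_distrib, hc,
    ← Finset.sum_mul] at e
  linarith

/-- The Reeb vector field is divergence-free. -/
theorem trace_A : ∑ i, G (A (b i)) (c i) = 0 := by
  -- Since η ∘ φ = 0, pairing with ξ kills the left side and isolates div ξ.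
  have := h.sum_φ_P hbc ξ
  simp only [h.η_φ, h.ξ_ξ, Finset.sum_const_zero, mul_one] at this
  linarith

/-- The divergence of `φ` is a multiple of the Reeb vector field. -/
theorem sum_P {w : E} (hw : G w ξ = 0) : ∑ i, G w (P (b i) (c i)) = 0 := by
  -- Pairing with φ w produces φ², which acts as the identity against w ⊥ ξ.
  have e := h.sum_φ_P hbc (φ w)
  rw [h.trace_A hbc, zero_mul, neg_zero] at e
  rw [← neg_eq_zero, ← e, ← Finset.sum_neg_distrib]
  refine Finset.sum_congr rfl fun i _ ↦ ?_
  have e1 := congrArg (G w) (h.φ_sq (P (b i) (c i)))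
  rw [map_sub, map_smul, hw, smul_zero, sub_zero] at e1
  rw [← e1, h.φ_skew, h.symm, neg_neg]

/-- The rough Laplacian of the Reeb vector field is orthogonal to every `w ⊥ ξ` with
`ϱ(w, ξ) = 0`. Here `B = ∇²ξ`. -/
theorem sum_B {B : E →L[ℝ] E →L[ℝ] E}
    (hB : ∀ w u v, G (B w u) v - G (B w v) u = 2 * G u (P w v))
    (hB' : ∀ w, ∑ i, G (B w (b i)) (c i) = 0) {w : E} (hw : G w ξ = 0)
    (hric : ∑ i, G (B (b i) w - B w (b i)) (c i) = 0) :
    ∑ i, G (B (b i) (c i)) w = 0 := by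
  have e1 : ∑ i, G (B (b i) w) (c i) = 0 := by
    simpa [Finset.sum_sub_distrib, hB' w] using hric
  -- Exchanging `c i` and `w` through `hB` costs twice the divergence of φ; the trace that remains
  -- is the one in the Ricci identity.
  calc ∑ i, G (B (b i) (c i)) w = ∑ i, (G (B (b i) w) (c i) - 2 * G w (P (b i) (c i))) := by
        refine Finset.sum_congr rfl fun i _ ↦ ?_
        have := hB (b i) (c i) w
        have := h.P_skew (b i) (c i) w
        linarith
    _ = 0 := by rw [Finset.sum_sub_distrib, e1, ← Finset.mul_sum, h.sum_P hbc hw]; simp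

end ParacontactAt

end DualPair

end Paracontact
end

noncomputable section

namespace Paracontact

/-! ### Levi-Civita calculus on an open subset of a vector space. -/

section LocalGeometry

set_option maxSynthPendingDepth 3

variable {E : Type*} [NormedAddCommGroup E] [NormedSpace ℝ E]

/-- `G` is a smooth field of symmetric nondegenerate bilinear forms on the open set `U`. -/
structure IsLocalMetric (U : Set E) (G : E → E →L[ℝ] E →L[ℝ] ℝ) : Prop where
  isOpen : IsOpen U
  contDiffOn : ContDiffOn ℝ ∞ G U
  symm : ∀ z ∈ U, ∀ u v, G z u v = G z v u
  nondegenerate : ∀ z ∈ U, ∀ u, (∀ v, G z u v = 0) → u = 0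

/-- The derivative of the metric in the arrangement `(u, v) ↦ (w ↦ 2 g(Γ(u, v), w))`, divided
by two. -/
def christoffelLower (G : E → E →L[ℝ] E →L[ℝ] ℝ) (z : E) : E →L[ℝ] E →L[ℝ] E →L[ℝ] ℝ :=
  (1 / 2 : ℝ) • (fderiv ℝ G z + (fderiv ℝ G z).flip -
    ((ContinuousLinearMap.flipₗᵢ ℝ E E ℝ).toContinuousLinearEquiv :
      (E →L[ℝ] E →L[ℝ] ℝ) →L[ℝ] E →L[ℝ] E →L[ℝ] ℝ) ∘L (fderiv ℝ G z).flip)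

/-- The isomorphism from covectors to vectors given by the metric `G`. -/
def sharp (G : E → E →L[ℝ] E →L[ℝ] ℝ) (z : E) : (E →L[ℝ] ℝ) →L[ℝ] E := (G z).inverse

/-- The Christoffel symbols of the metric `G`. -/
def christoffel (G : E → E →L[ℝ] E →L[ℝ] ℝ) (z : E) : E →L[ℝ] E →L[ℝ] E :=
  (ContinuousLinearMap.compL ℝ E (E →L[ℝ] ℝ) E (sharp G z)) ∘L christoffelLower G z

/-- The covariant derivative `u ↦ ∇_u Y` of a vector field. -/
def covD (G : E → E →L[ℝ] E →L[ℝ] ℝ) (Y : E → E) (z : E) : E →L[ℝ] E :=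
  fderiv ℝ Y z + (christoffel G z).flip (Y z)

/-- The covariant derivative `(u, v) ↦ (∇_u A) v` of a field of endomorphisms. -/
def covEnd (G : E → E →L[ℝ] E →L[ℝ] ℝ) (A : E → E →L[ℝ] E) (z : E) : E →L[ℝ] E →L[ℝ] E :=
  fderiv ℝ A z + ((ContinuousLinearMap.compL ℝ E E E).flip (A z)) ∘L christoffel G z -
    (ContinuousLinearMap.compL ℝ E E E (A z)) ∘L christoffel G z

@[simp]
theorem covD_apply (G : E → E →L[ℝ] E →L[ℝ] ℝ) (Y : E → E) (z u : E) :
    covD G Y z u = fderiv ℝ Y z u + christoffel G z u (Y z) := rfl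

@[simp]
theorem covEnd_apply (G : E → E →L[ℝ] E →L[ℝ] ℝ) (A : E → E →L[ℝ] E) (z u v : E) :
    covEnd G A z u v = fderiv ℝ A z u v + christoffel G z u (A z v) - A z (christoffel G z u v) :=
  rfl

/-- The curvature tensor, with the sign convention `R_{uv} = ∇_{[u,v]} - [∇_u, ∇_v]`. -/
def riemann (G : E → E →L[ℝ] E →L[ℝ] ℝ) (z u v w : E) : E :=
  -(fderiv ℝ (christoffel G) z u v w - fderiv ℝ (christoffel G) z v u w
    + christoffel G z u (christoffel G z v w) - christoffel G z v (christoffel G z u w))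

theorem fderiv_bilin_apply {G : E → E →L[ℝ] E →L[ℝ] ℝ} {X Y : E → E} {z : E}
    (hG : DifferentiableAt ℝ G z) (hX : DifferentiableAt ℝ X z) (hY : DifferentiableAt ℝ Y z)
    (w : E) : fderiv ℝ (fun y ↦ G y (X y) (Y y)) z w =
      fderiv ℝ G z w (X z) (Y z) + G z (fderiv ℝ X z w) (Y z) + G z (X z) (fderiv ℝ Y z w) := by
  have h := ((hG.hasFDerivAt.clm_apply hX.hasFDerivAt).clm_apply hY.hasFDerivAt).fderiv
  rw [h]
  simp
  ring

theorem fderiv_end_apply {F : Type*} [NormedAddCommGroup F] [NormedSpace ℝ F]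
    {A : E → E →L[ℝ] F} {X : E → E} {z : E}
    (hA : DifferentiableAt ℝ A z) (hX : DifferentiableAt ℝ X z)
    (w : E) : fderiv ℝ (fun y ↦ A y (X y)) z w =
      fderiv ℝ A z w (X z) + A z (fderiv ℝ X z w) := by
  rw [(hA.hasFDerivAt.clm_apply hX.hasFDerivAt).fderiv]
  simp
  abel

theorem fderiv_eq_of_eqOn {F : Type*} [NormedAddCommGroup F] [NormedSpace ℝ F] {U : Set E}
    (hU : IsOpen U) {f f' : E → F} (h : ∀ y ∈ U, f y = f' y) {z : E} (hz : z ∈ U) :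
    fderiv ℝ f z = fderiv ℝ f' z :=
  Filter.EventuallyEq.fderiv_eq (Filter.eventually_of_mem (hU.mem_nhds hz) h)

theorem contDiffAt_of_mem {F : Type*} [NormedAddCommGroup F] [NormedSpace ℝ F] {U : Set E}
    (hU : IsOpen U) {f : E → F} {n : ℕ∞ω} (h : ContDiffOn ℝ n f U) {z : E} (hz : z ∈ U) :
    ContDiffAt ℝ n f z := h.contDiffAt (hU.mem_nhds hz)

theorem differentiableAt_of_mem {F : Type*} [NormedAddCommGroup F] [NormedSpace ℝ F] {U : Set E}
    (hU : IsOpen U) {f : E → F} (h : ContDiffOn ℝ ∞ f U) {z : E} (hz : z ∈ U) :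
    DifferentiableAt ℝ f z := (contDiffAt_of_mem hU h hz).differentiableAt (by simp)

namespace IsLocalMetric

variable {U : Set E} {G : E → E →L[ℝ] E →L[ℝ] ℝ} (hG : IsLocalMetric U G)
include hG

theorem differentiableAt {z : E} (hz : z ∈ U) : DifferentiableAt ℝ G z :=
  differentiableAt_of_mem hG.isOpen hG.contDiffOn hz

theorem fderiv_symm {z : E} (hz : z ∈ U) (w u v : E) :
    fderiv ℝ G z w u v = fderiv ℝ G z w v u := by
  have h := fderiv_eq_of_eqOn (f := fun y ↦ G y u v) (f' := fun y ↦ G y v u) hG.isOpen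
    (fun y hy ↦ hG.symm y hy u v) hz
  have h1 := fderiv_bilin_apply (hG.differentiableAt hz) (differentiableAt_const u)
    (differentiableAt_const v) w
  have h2 := fderiv_bilin_apply (hG.differentiableAt hz) (differentiableAt_const v)
    (differentiableAt_const u) w
  rw [h] at h1
  simpa using h1.symm.trans h2

variable [FiniteDimensional ℝ E]

theorem isInvertible {z : E} (hz : z ∈ U) : (G z).IsInvertible := by
  have hinj : Function.Injective ((G z : E →L[ℝ] E →L[ℝ] ℝ) : E →ₗ[ℝ] E →L[ℝ] ℝ) := by
    rw [← LinearMap.ker_eq_bot, LinearMap.ker_eq_bot']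
    intro u hu
    exact hG.nondegenerate z hz u fun v ↦ by
      have := congrArg (fun f : E →L[ℝ] ℝ ↦ f v) hu
      simpa using this
  have hdim : Module.finrank ℝ E = Module.finrank ℝ (E →L[ℝ] ℝ) := by
    rw [← (LinearMap.toContinuousLinearMap (𝕜 := ℝ) (E := E) (F' := ℝ)).finrank_eq]
    exact (Subspace.dual_finrank_eq (K := ℝ) (V := E)).symm
  let e := LinearEquiv.ofInjectiveOfFinrankEq _ hinj hdim
  exact ⟨e.toContinuousLinearEquiv, by ext; rfl⟩

theorem G_sharp {z : E} (hz : z ∈ U) (α : E →L[ℝ] ℝ) : G z (sharp G z α) = α :=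
  (hG.isInvertible hz).self_apply_inverse α

omit [FiniteDimensional ℝ E] in
theorem ext_G {z : E} (hz : z ∈ U) {u u' : E} (h : ∀ v, G z u v = G z u' v) : u = u' :=
  sub_eq_zero.1 (hG.nondegenerate z hz _ fun v ↦ by simp [h v])

/-- Inversion of continuous linear maps is smooth at invertible maps. -/
theorem contDiffOn_sharp : ContDiffOn ℝ ∞ (sharp G) U := by
  intro z hz
  obtain ⟨e, he⟩ := hG.isInvertible hz
  have := contDiffAt_map_inverse (𝕜 := ℝ) (n := ∞) e
  rw [he] at this
  exact (this.comp z (contDiffAt_of_mem hG.isOpen hG.contDiffOn hz)).contDiffWithinAt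

omit [FiniteDimensional ℝ E] in
theorem contDiffOn_fderiv : ContDiffOn ℝ ∞ (fderiv ℝ G) U :=
  hG.contDiffOn.fderiv_of_isOpen hG.isOpen (by simp)

set_option synthInstance.maxHeartbeats 200000 in
theorem contDiffOn_christoffel : ContDiffOn ℝ ∞ (christoffel G) U := by
  have h := hG.contDiffOn_fderiv
  have hflip : ContDiffOn ℝ ∞ (fun z ↦ (fderiv ℝ G z).flip) U :=
    (ContinuousLinearMap.flipₗᵢ ℝ E E (E →L[ℝ] ℝ)).toContinuousLinearEquiv.contDiff.comp_contDiffOn h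
  have h2 : ContDiffOn ℝ ∞ (christoffelLower G) U :=
    ((h.add hflip).sub (contDiffOn_const.clm_comp hflip)).const_smul _
  exact (((ContinuousLinearMap.compL ℝ E (E →L[ℝ] ℝ) E).contDiff.comp_contDiffOn
    hG.contDiffOn_sharp)).clm_comp h2

theorem G_christoffel {z : E} (hz : z ∈ U) (u v w : E) :
    G z (christoffel G z u v) w =
      1 / 2 * (fderiv ℝ G z u v w + fderiv ℝ G z v u w - fderiv ℝ G z w u v) := by
  have : G z (christoffel G z u v) = christoffelLower G z u v := hG.G_sharp hz _
  rw [this]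
  rfl

theorem christoffel_symm {z : E} (hz : z ∈ U) (u v : E) :
    christoffel G z u v = christoffel G z v u := by
  refine hG.ext_G hz fun w ↦ ?_
  rw [hG.G_christoffel hz, hG.G_christoffel hz, hG.fderiv_symm hz w u v]
  ring

/-- Metric compatibility ∇G = 0, read off from the Koszul form of the Christoffel symbols. -/
theorem fderiv_eq {z : E} (hz : z ∈ U) (w u v : E) : fderiv ℝ G z w u v =
    G z (christoffel G z w u) v + G z u (christoffel G z w v) := by
  rw [hG.symm z hz u, hG.G_christoffel hz, hG.G_christoffel hz, hG.fderiv_symm hz v w u,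
    hG.fderiv_symm hz w v u, hG.fderiv_symm hz u w v]
  ring

theorem fderiv_apply_eq {X Y : E → E} {z : E} (hz : z ∈ U) (hX : DifferentiableAt ℝ X z)
    (hY : DifferentiableAt ℝ Y z) (w : E) : fderiv ℝ (fun y ↦ G y (X y) (Y y)) z w =
      G z (covD G X z w) (Y z) + G z (X z) (covD G Y z w) := by
  rw [fderiv_bilin_apply (hG.differentiableAt hz) hX hY, hG.fderiv_eq hz]
  simp
  ring

/-- Antisymmetrizing in `u` and `v` removes the Christoffel term, so that dη is expressed by ∇ξ
alone. -/
theorem fderiv_flat {ξ : E → E} {z : E} (hz : z ∈ U) (hξ : DifferentiableAt ℝ ξ z) (u v : E) :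
    fderiv ℝ (fun y ↦ G y (ξ y)) z u v =
      G z (covD G ξ z u) v + G z (ξ z) (christoffel G z u v) := by
  rw [fderiv_end_apply (hG.differentiableAt hz) hξ]
  simp only [add_apply, hG.fderiv_eq hz, covD_apply, map_add]
  ring

theorem contDiffAt_covD {Y : E → E} {z : E} (hz : z ∈ U) (hY : ContDiffAt ℝ ∞ Y z) :
    ContDiffAt ℝ ∞ (covD G Y) z := by
  have hflip : ContDiffAt ℝ ∞ (fun z ↦ (christoffel G z).flip) z :=
    (ContinuousLinearMap.flipₗᵢ ℝ E E E).toContinuousLinearEquiv.contDiff.contDiffAt.comp z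
      (contDiffAt_of_mem hG.isOpen hG.contDiffOn_christoffel hz)
  exact (hY.fderiv_right (by simp)).add (hflip.clm_apply hY)

theorem contDiffOn_covD {Y : E → E} (hY : ContDiffOn ℝ ∞ Y U) : ContDiffOn ℝ ∞ (covD G Y) U := by
  exact fun z hz ↦ (hG.contDiffAt_covD hz (contDiffAt_of_mem hG.isOpen hY hz)).contDiffWithinAt

/-- The Ricci identity. Second derivatives of `Y` and the symmetric Γ(u, v) cancel, leaving
derivatives and products of Γ; the minus sign comes from the curvature convention. -/
theorem covEnd_covD {Y : E → E} {z : E} (hz : z ∈ U) (hY : ContDiffAt ℝ 2 Y z) (u v : E) :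
    covEnd G (covD G Y) z u v - covEnd G (covD G Y) z v u = - riemann G z u v (Y z) := by
  have hΓ : DifferentiableAt ℝ (christoffel G) z :=
    differentiableAt_of_mem hG.isOpen hG.contDiffOn_christoffel hz
  have hflip : DifferentiableAt ℝ (fun z ↦ (christoffel G z).flip) z :=
    (ContinuousLinearMap.flipₗᵢ ℝ E E E).toContinuousLinearEquiv.differentiableAt.comp z hΓ
  have hY1 : DifferentiableAt ℝ Y z := hY.differentiableAt (by simp)
  have hY2 : DifferentiableAt ℝ (fderiv ℝ Y) z :=
    (hY.fderiv_right (m := 1) (by norm_num)).differentiableAt (by simp)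
  have hsymm : ∀ u v, fderiv ℝ (fderiv ℝ Y) z u v = fderiv ℝ (fderiv ℝ Y) z v u :=
    fun u v ↦ hY.isSymmSndFDerivAt (by simp) u v
  have hD : ∀ u v, fderiv ℝ (covD G Y) z u v = fderiv ℝ (fderiv ℝ Y) z u v +
      fderiv ℝ (christoffel G) z u v (Y z) + christoffel G z v (fderiv ℝ Y z u) := by
    intro u v
    have e1 : fderiv ℝ (fun y ↦ (christoffel G y).flip) z u = (fderiv ℝ (christoffel G) z u).flip := by
      have := ((ContinuousLinearMap.flipₗᵢ ℝ E E E).toContinuousLinearEquiv.hasFDerivAt.comp z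
        hΓ.hasFDerivAt).fderiv
      exact congrArg (fun f ↦ f u) this
    have e2 : fderiv ℝ (covD G Y) z = fderiv ℝ (fderiv ℝ Y) z +
        fderiv ℝ (fun y ↦ (christoffel G y).flip (Y y)) z :=
      fderiv_fun_add hY2 (hflip.clm_apply hY1)
    rw [e2, add_apply, fderiv_end_apply hflip hY1, e1]
    simp [add_assoc]
  simp only [covEnd_apply, hD, riemann, hsymm u v, covD_apply, map_add,
    hG.christoffel_symm hz u v]
  abel

/-- The curvature formula for vector fields. -/
theorem covD_lieBracket {X Y W : E → E} {z : E} (hz : z ∈ U) (hX : DifferentiableAt ℝ X z)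
    (hY : DifferentiableAt ℝ Y z) (hW : ContDiffAt ℝ 2 W z) :
    covD G W z (VectorField.lieBracket ℝ X Y z) -
      (covD G (fun y ↦ covD G W y (Y y)) z (X z) - covD G (fun y ↦ covD G W y (X y)) z (Y z)) =
      riemann G z (X z) (Y z) (W z) := by
  have hΓ : DifferentiableAt ℝ (christoffel G) z :=
    differentiableAt_of_mem hG.isOpen hG.contDiffOn_christoffel hz
  have hflip : DifferentiableAt ℝ (fun z ↦ (christoffel G z).flip) z :=
    (ContinuousLinearMap.flipₗᵢ ℝ E E E).toContinuousLinearEquiv.differentiableAt.comp z hΓ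
  have hA : DifferentiableAt ℝ (covD G W) z :=
    ((hW.fderiv_right (m := 1) (by norm_num)).differentiableAt (by simp)).add
      (hflip.clm_apply (hW.differentiableAt (by simp)))
  -- ∇_X(∇_Y W) is the second covariant derivative of W plus ∇W applied to ∇_X Y. After
  -- antisymmetrization the Γ(X, Y) part cancels and the derivatives of X and Y assemble to the Lie
  -- bracket.
  have key : ∀ X Y : E → E, DifferentiableAt ℝ Y z →
      covD G (fun y ↦ covD G W y (Y y)) z (X z) = covEnd G (covD G W) z (X z) (Y z) +
        covD G W z (christoffel G z (X z) (Y z)) + covD G W z (fderiv ℝ Y z (X z)) := by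
    intro X Y hY
    rw [covD_apply, fderiv_end_apply hA hY, covEnd_apply]
    abel
  have := hG.covEnd_covD hz hW (X z) (Y z)
  rw [key X Y hY, key Y X hX, VectorField.lieBracket_eq, hG.christoffel_symm hz (Y z) (X z),
    map_sub, ← neg_neg (riemann G z _ _ _), ← this]
  abel

end IsLocalMetric

/-- A paracontact metric structure on an open subset of a vector space. -/
structure IsLocalParacontact (U : Set E) (G : E → E →L[ℝ] E →L[ℝ] ℝ) (ξ : E → E)
    (φ : E → E →L[ℝ] E) : Prop extends IsLocalMetric U G where
  contDiffOn_ξ : ContDiffOn ℝ ∞ ξ U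
  contDiffOn_φ : ContDiffOn ℝ ∞ φ U
  ξ_ξ : ∀ z ∈ U, G z (ξ z) (ξ z) = 1
  dη_eq : ∀ z ∈ U, ∀ u v, 1 / 2 * (fderiv ℝ (fun y ↦ G y (ξ y)) z u v -
    fderiv ℝ (fun y ↦ G y (ξ y)) z v u) = G z u (φ z v)
  dη_ξ : ∀ z ∈ U, ∀ u, G z (ξ z) (φ z u) = 0
  φ_sq : ∀ z ∈ U, ∀ u, φ z (φ z u) = u - G z (ξ z) u • ξ z

namespace IsLocalParacontact

variable {U : Set E} {G : E → E →L[ℝ] E →L[ℝ] ℝ} {ξ : E → E} {φ : E → E →L[ℝ] E}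
  (h : IsLocalParacontact U G ξ φ)
include h

theorem differentiableAt_ξ {z : E} (hz : z ∈ U) : DifferentiableAt ℝ ξ z :=
  differentiableAt_of_mem h.isOpen h.contDiffOn_ξ hz

theorem differentiableAt_φ {z : E} (hz : z ∈ U) : DifferentiableAt ℝ φ z :=
  differentiableAt_of_mem h.isOpen h.contDiffOn_φ hz

variable [FiniteDimensional ℝ E]

theorem skew_covD {z : E} (hz : z ∈ U) (u v : E) :
    G z (covD G ξ z u) v - G z (covD G ξ z v) u = 2 * G z u (φ z v) := by
  have hξ := h.differentiableAt_ξ hz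
  rw [← h.dη_eq z hz, h.fderiv_flat hz hξ, h.fderiv_flat hz hξ, h.toIsLocalMetric.christoffel_symm hz v u]
  ring

theorem φ_skew {z : E} (hz : z ∈ U) (u v : E) : G z u (φ z v) = - G z v (φ z u) := by
  have h1 := h.skew_covD hz u v
  have h2 := h.skew_covD hz v u
  linarith

/-- The covariant derivative of `skew_covD`. Derivatives of G are rewritten by Γ, and `skew_covD`
itself, applied with Γ(w, u) or Γ(w, v) in a slot, absorbs the Christoffel corrections. -/
theorem skew_covEnd {z : E} (hz : z ∈ U) (w u v : E) :
    G z (covEnd G (covD G ξ) z w u) v - G z (covEnd G (covD G ξ) z w v) u =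
      2 * G z u (covEnd G φ z w v) := by
  have hA : DifferentiableAt ℝ (covD G ξ) z := differentiableAt_of_mem h.isOpen
    (h.toIsLocalMetric.contDiffOn_covD h.contDiffOn_ξ) hz
  have hGd := h.differentiableAt hz
  have hφ := h.differentiableAt_φ hz
  have hAu : ∀ u, DifferentiableAt ℝ (fun y ↦ covD G ξ y u) z := fun u ↦
    hA.clm_apply (differentiableAt_const u)
  have hφv : DifferentiableAt ℝ (fun y ↦ φ y v) z := hφ.clm_apply (differentiableAt_const v)
  have e := fderiv_eq_of_eqOn h.isOpen (fun y hy ↦ h.skew_covD hy u v) hz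
  have e1 : ∀ u v, fderiv ℝ (fun y ↦ G y (covD G ξ y u) v) z w =
      fderiv ℝ G z w (covD G ξ z u) v + G z (fderiv ℝ (covD G ξ) z w u) v := fun u v ↦ by
    rw [fderiv_bilin_apply hGd (hAu u) (differentiableAt_const v),
      fderiv_end_apply hA (differentiableAt_const u)]
    simp
  have e2 : fderiv ℝ (fun y ↦ G y u (φ y v)) z w =
      fderiv ℝ G z w u (φ z v) + G z u (fderiv ℝ φ z w v) := by
    rw [fderiv_bilin_apply hGd (differentiableAt_const u) hφv,
      fderiv_end_apply hφ (differentiableAt_const v)]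
    simp
  have hd : ∀ u v, DifferentiableAt ℝ (fun y ↦ G y (covD G ξ y u) v) z := fun u v ↦
    (hGd.clm_apply (hAu u)).clm_apply (differentiableAt_const v)
  have hd' : DifferentiableAt ℝ (fun y ↦ G y u (φ y v)) z :=
    (hGd.clm_apply (differentiableAt_const u)).clm_apply hφv
  have e3 := congrArg (fun f ↦ f w) e
  simp only [fderiv_fun_sub (hd u v) (hd v u), fderiv_const_mul hd',
    sub_apply, smul_apply, smul_eq_mul, e1, e2,
    h.toIsLocalMetric.fderiv_eq hz] at e3
  have s1 := h.skew_covD hz (christoffel G z w u) v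
  have s2 := h.skew_covD hz u (christoffel G z w v)
  simp only [covEnd_apply, map_add, map_sub, add_apply,
    sub_apply]
  have t1 := h.symm z hz (covD G ξ z (christoffel G z w u)) v
  linarith

end IsLocalParacontact

end LocalGeometry

end Paracontact
end

noncomputable section

namespace Paracontact

/-! ### The density, the coordinate divergence and the rough Laplacian of ξ. -/

section LocalEulerLagrange

set_option maxSynthPendingDepth 3

variable {E : Type*} [NormedAddCommGroup E] [NormedSpace ℝ E] [FiniteDimensional ℝ E]
  {ι : Type*}

/-- The coordinate functionals of a basis, as continuous linear maps. -/
def coordL (b : Module.Basis ι ℝ E) (i : ι) : E →L[ℝ] ℝ := LinearMap.toContinuousLinearMap (b.coord i)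

@[simp]
theorem coordL_apply (b : Module.Basis ι ℝ E) (i : ι) (v : E) : coordL b i v = b.repr v i := rfl

variable [Fintype ι]

/-- The trace of a commutator vanishes; this makes the trace commute with covariant differentiation
of endomorphisms. -/
theorem sum_coordL_comm (b : Module.Basis ι ℝ E) (S T : E →L[ℝ] E) :
    ∑ i, coordL b i (S (T (b i))) = ∑ i, coordL b i (T (S (b i))) := by
  have key : ∀ S T : E →L[ℝ] E, ∑ i, coordL b i (S (T (b i))) =
      ∑ i, ∑ j, coordL b j (T (b i)) * coordL b i (S (b j)) := by
    intro S T
    refine Finset.sum_congr rfl fun i _ ↦ ?_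
    conv_lhs => rw [← b.sum_repr (T (b i))]
    simp only [map_sum, map_smul, smul_eq_mul, coordL_apply]
  rw [key, key, Finset.sum_comm]
  simp_rw [mul_comm]

/-- The frame dual to the basis `b` with respect to the metric `G`. -/
def dualFrame (G : E → E →L[ℝ] E →L[ℝ] ℝ) (b : Module.Basis ι ℝ E) (z : E) (i : ι) : E :=
  sharp G z (coordL b i)

namespace IsLocalMetric

variable {U : Set E} {G : E → E →L[ℝ] E →L[ℝ] ℝ} (hG : IsLocalMetric U G) (b : Module.Basis ι ℝ E)
include hG

omit [Fintype ι] in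
theorem G_dualFrame {z : E} (hz : z ∈ U) (v : E) (i : ι) :
    G z v (dualFrame G b z i) = coordL b i v := by
  rw [hG.symm z hz, dualFrame, hG.G_sharp hz]

theorem isDualPair {z : E} (hz : z ∈ U) : IsDualPair (G z) b (dualFrame G b z) where
  left v := by simp only [hG.G_dualFrame b hz, coordL_apply, b.sum_repr]
  right v := by
    refine hG.ext_G hz fun w ↦ ?_
    have : G z (∑ i, G z v (b i) • dualFrame G b z i) w = G z v (∑ i, b.repr w i • b i) := by
      simp only [map_sum, map_smul, sum_apply, smul_apply, smul_eq_mul]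
      refine Finset.sum_congr rfl fun i _ ↦ ?_
      rw [hG.symm z hz _ w, hG.G_dualFrame b hz, coordL_apply, mul_comm]
    rw [this, b.sum_repr]

omit [Fintype ι] in
theorem contDiffOn_dualFrame (i : ι) : ContDiffOn ℝ ∞ (fun z ↦ dualFrame G b z i) U :=
  hG.contDiffOn_sharp.clm_apply contDiffOn_const

/-- The vector field `X` with `g(X, u) = g(A u, Y)`. -/
theorem G_sharp_comp {A : E → E →L[ℝ] E} {Y : E → E} {z : E} (hz : z ∈ U) (u : E) :
    G z (sharp G z (G z (Y z) ∘L A z)) u = G z (Y z) (A z u) := by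
  rw [hG.G_sharp hz]; rfl

/-- As G is parallel, ∇ passes through `sharp`, and the Leibniz rule applies to g(Y, A ·). -/
theorem G_covD_sharp {A : E → E →L[ℝ] E} {Y : E → E} {z : E} (hz : z ∈ U)
    (hA : DifferentiableAt ℝ A z) (hY : DifferentiableAt ℝ Y z)
    (hX : DifferentiableAt ℝ (fun y ↦ sharp G y (G y (Y y) ∘L A y)) z) (v u : E) :
    G z (covD G (fun y ↦ sharp G y (G y (Y y) ∘L A y)) z v) u =
      G z (covD G Y z v) (A z u) + G z (Y z) (covEnd G A z v u) := by
  have e := congrArg (fun f ↦ f v)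
    (fderiv_eq_of_eqOn hG.isOpen (fun y hy ↦ hG.G_sharp_comp (A := A) (Y := Y) hy u) hz)
  have hAu : DifferentiableAt ℝ (fun y ↦ A y u) z := hA.clm_apply (differentiableAt_const u)
  simp only [hG.fderiv_apply_eq hz hX (differentiableAt_const u),
    hG.fderiv_apply_eq hz hY hAu] at e
  have e2 := hG.G_sharp_comp (A := A) (Y := Y) hz (christoffel G z v u)
  have e3 := fderiv_end_apply hA (differentiableAt_const u) v
  simp only [covD_apply, covEnd_apply, map_add, map_sub, e3, fderiv_fun_const, Pi.zero_apply,
    zero_apply, map_zero, add_zero, zero_add, add_apply] at e e2 ⊢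
  linarith

variable [DecidableEq ι]

/-- The matrix of the metric with respect to a basis. -/
def _root_.Paracontact.gram (G : E → E →L[ℝ] E →L[ℝ] ℝ) (b : Module.Basis ι ℝ E) (z : E) :
    Matrix ι ι ℝ := Matrix.of fun i j ↦ G z (b i) (b j)

/-- The density of the volume measure. -/
def _root_.Paracontact.density (G : E → E →L[ℝ] E →L[ℝ] ℝ) (b : Module.Basis ι ℝ E) (z : E) : ℝ :=
  √|(gram G b z).det|

omit [FiniteDimensional ℝ E] in
theorem det_gram_ne_zero {z : E} (hz : z ∈ U) : (gram G b z).det ≠ 0 := by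
  intro h0
  obtain ⟨v, hv, h⟩ := Matrix.exists_mulVec_eq_zero_iff.2 h0
  apply hv
  have h1 : ∑ j, v j • b j = 0 := by
    refine hG.nondegenerate z hz _ fun w ↦ ?_
    have h2 : ∀ i, G z (b i) (∑ j, v j • b j) = 0 := fun i ↦ by
      have := congrFun h i
      simp only [Matrix.mulVec, dotProduct, gram, Matrix.of_apply, Pi.zero_apply] at this
      simp only [map_smul, map_sum, smul_eq_mul, mul_comm (v _), this]
    have h3 := (isBilin_clm (G z)).sum_fst (b.repr w) b (∑ j, v j • b j)
    rw [hG.symm z hz, ← b.sum_repr w, h3]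
    simp only [h2, mul_zero, Finset.sum_const_zero]
  have := Fintype.linearIndependent_iff.1 b.linearIndependent v h1
  exact funext this

-- Jacobi's formula: the determinant is multilinear in the rows, so its derivative replaces one row
-- at a time, and Cramer's rule expands each resulting determinant in adjugate entries.
omit hG [FiniteDimensional ℝ E] in
theorem _root_.Paracontact.hasFDerivAt_det {M : E → Matrix ι ι ℝ} {M' : ι → ι → E →L[ℝ] ℝ} {z : E}
    (h : ∀ i j, HasFDerivAt (fun y ↦ M y i j) (M' i j) z) (w : E) :
    DifferentiableAt ℝ (fun y ↦ (M y).det) z ∧ fderiv ℝ (fun y ↦ (M y).det) z w =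
      ((M z).adjugate * Matrix.of fun i j ↦ M' i j w).trace := by
  let D : ContinuousMultilinearMap ℝ (fun _ : ι ↦ ι → ℝ) ℝ :=
    { toMultilinearMap := (Matrix.detRowAlternating (n := ι) (R := ℝ)).toMultilinearMap
      cont := Continuous.matrix_det (A := fun x : ι → ι → ℝ ↦ (Matrix.of x : Matrix ι ι ℝ))
        continuous_id }
  have hM : HasFDerivAt (fun y ↦ (fun i j ↦ M y i j : ι → ι → ℝ))
      (ContinuousLinearMap.pi fun i ↦ ContinuousLinearMap.pi fun j ↦ M' i j) z :=
    hasFDerivAt_pi.2 fun i ↦ hasFDerivAt_pi.2 fun j ↦ h i j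
  have hD := (D.hasFDerivAt (fun i j ↦ M z i j)).comp z hM
  have hfun : (fun y ↦ (M y).det) = D ∘ (fun y ↦ (fun i j ↦ M y i j : ι → ι → ℝ)) := rfl
  rw [hfun]
  refine ⟨hD.differentiableAt, ?_⟩
  rw [hD.fderiv, ContinuousLinearMap.comp_apply, ContinuousMultilinearMap.linearDeriv_apply]
  have : ∀ i, D (Function.update (fun i j ↦ M z i j) i
      ((ContinuousLinearMap.pi fun i ↦ ContinuousLinearMap.pi fun j ↦ M' i j) w i)) =
      ∑ j, (M z).adjugate j i * M' i j w := by
    intro i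
    have h1 : D (Function.update (fun i j ↦ M z i j) i
      ((ContinuousLinearMap.pi fun i ↦ ContinuousLinearMap.pi fun j ↦ M' i j) w i)) =
      ((M z).updateRow i (fun j ↦ M' i j w)).det := rfl
    rw [h1, ← Matrix.cramer_transpose_apply, Matrix.cramer_eq_adjugate_mulVec,
      ← Matrix.adjugate_transpose]
    rfl
  simp only [this, Matrix.trace, Matrix.diag, Matrix.mul_apply, Matrix.of_apply]
  rw [Finset.sum_comm]

/-- With N the matrix of Γ(w, ·), metric compatibility says that the Gram matrix g has derivative
Nᵀg + gN. Against the adjugate of g, each summand has trace tr N · det g. -/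
theorem fderiv_det_gram {z : E} (hz : z ∈ U) (w : E) :
    DifferentiableAt ℝ (fun y ↦ (gram G b y).det) z ∧ fderiv ℝ (fun y ↦ (gram G b y).det) z w =
      2 * (∑ i, coordL b i (christoffel G z w (b i))) * (gram G b z).det := by
  have hGd := hG.differentiableAt hz
  have hM : ∀ i j, HasFDerivAt (fun y ↦ gram G b y i j)
      (fderiv ℝ (fun y ↦ G y (b i) (b j)) z) z := fun i j ↦
    ((hGd.clm_apply (differentiableAt_const _)).clm_apply (differentiableAt_const _)).hasFDerivAt
  obtain ⟨h1, h2⟩ := hasFDerivAt_det hM w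
  refine ⟨h1, h2.trans ?_⟩
  let N : Matrix ι ι ℝ := Matrix.of fun k i ↦ coordL b k (christoffel G z w (b i))
  have hD : (Matrix.of fun i j ↦ fderiv ℝ (fun y ↦ G y (b i) (b j)) z w) =
      N.transpose * gram G b z + gram G b z * N := by
    ext i j
    rw [Matrix.of_apply, fderiv_bilin_apply hGd (differentiableAt_const _)
      (differentiableAt_const _), hG.fderiv_eq hz]
    have e1 := (isBilin_clm (G z)).sum_fst (fun k ↦ coordL b k (christoffel G z w (b i))) b (b j)
    have e2 := (isBilin_clm (G z)).sum_snd (fun k ↦ coordL b k (christoffel G z w (b j))) b (b i)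
    simp only [coordL_apply, b.sum_repr] at e1 e2
    simp only [Matrix.add_apply, Matrix.mul_apply, Matrix.transpose_apply, N, gram, Matrix.of_apply,
      e1, e2, coordL_apply, mul_comm (G z (b i) (b _)), fderiv_fun_const, Pi.zero_apply, zero_apply,
      map_zero, add_zero]
  rw [hD, mul_add, Matrix.trace_add, ← mul_assoc, ← mul_assoc, Matrix.adjugate_mul,
    Matrix.trace_mul_comm, ← mul_assoc, Matrix.mul_adjugate]
  simp [Matrix.trace, N, Finset.mul_sum]
  rw [← Finset.sum_add_distrib]
  rw [Finset.sum_mul]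
  exact Finset.sum_congr rfl fun i _ ↦ by ring

theorem fderiv_density {z : E} (hz : z ∈ U) (w : E) :
    DifferentiableAt ℝ (density G b) z ∧ fderiv ℝ (density G b) z w =
      density G b z * ∑ i, coordL b i (christoffel G z w (b i)) := by
  obtain ⟨h1, h2⟩ := hG.fderiv_det_gram b hz w
  have h0 := hG.det_gram_ne_zero b hz
  have h3 := ((hasDerivAt_abs h0).sqrt (abs_ne_zero.2 h0)).comp_hasFDerivAt z h1.hasFDerivAt
  refine ⟨h3.differentiableAt, ?_⟩
  have h4 := congrArg (fun f ↦ f w) h3.fderiv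
  refine Eq.trans h4 ?_
  rw [smul_apply, h2, density, smul_eq_mul]
  set d := (gram G b z).det
  -- The identity sign(d) d = |d| treats both signs of the determinant at once, so any signature is
  -- allowed.
  have hs : (SignType.sign d : ℝ) * d = √|d| * √|d| := by
    rw [Real.mul_self_sqrt (abs_nonneg _), sign_mul_self]
  have hp : √|d| ≠ 0 := (Real.sqrt_pos.2 (abs_pos.2 h0)).ne'
  field_simp
  rw [sq, ← hs]
  ring

/-- The divergence in coordinates. -/
theorem sum_fderiv_density_mul {X : E → E} {z : E} (hz : z ∈ U) (hX : DifferentiableAt ℝ X z) :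
    ∑ j, fderiv ℝ (fun y ↦ density G b y * coordL b j (X y)) z (b j) =
      density G b z * ∑ j, coordL b j (covD G X z (b j)) := by
  have hd := fun w ↦ hG.fderiv_density b hz w
  have hXj : ∀ j, HasFDerivAt (fun y ↦ coordL b j (X y)) (coordL b j ∘L fderiv ℝ X z) z :=
    fun j ↦ (coordL b j).hasFDerivAt.comp z hX.hasFDerivAt
  have e : ∀ j, fderiv ℝ (fun y ↦ density G b y * coordL b j (X y)) z (b j) =
      density G b z * coordL b j (fderiv ℝ X z (b j)) +
        coordL b j (X z) * fderiv ℝ (density G b) z (b j) := fun j ↦ by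
    rw [fderiv_fun_mul (hd 0).1 (hXj j).differentiableAt, (hXj j).fderiv]
    simp
  -- Because Γ is symmetric, the logarithmic derivative of the density along X is exactly the trace
  -- of the Christoffel part of ∇X.
  have e2 : ∑ j, coordL b j (X z) * fderiv ℝ (density G b) z (b j) =
      density G b z * ∑ j, coordL b j (christoffel G z (b j) (X z)) := by
    have : ∑ j, coordL b j (X z) * fderiv ℝ (density G b) z (b j) =
        fderiv ℝ (density G b) z (X z) := by
      conv_rhs => rw [← b.sum_repr (X z)]
      simp only [map_sum, map_smul, smul_eq_mul, coordL_apply]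
    rw [this, (hd _).2]
    simp_rw [hG.christoffel_symm hz (X z)]
  simp_rw [e]
  rw [Finset.sum_add_distrib, e2, ← Finset.mul_sum, ← mul_add, ← Finset.sum_add_distrib]
  simp

omit [FiniteDimensional ℝ E] in
theorem contDiffOn_density : ContDiffOn ℝ ∞ (density G b) U := by
  have h1 : ContDiffOn ℝ ∞ (fun y ↦ (gram G b y).det) U := by
    simp only [Matrix.det_apply]
    refine ContDiffOn.sum fun σ _ ↦ ContDiffOn.const_smul _ (contDiffOn_prod fun i _ ↦ ?_)
    exact (hG.contDiffOn.clm_apply contDiffOn_const).clm_apply contDiffOn_const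
  intro z hz
  have h0 := hG.det_gram_ne_zero b hz
  have h2 : ContDiffAt ℝ ∞ (fun y ↦ |(gram G b y).det|) z :=
    ContDiffAt.comp (g := abs) z (contDiffAt_abs h0) (contDiffAt_of_mem hG.isOpen h1 hz)
  exact (h2.sqrt (abs_ne_zero.2 h0)).contDiffWithinAt

end IsLocalMetric

namespace IsLocalParacontact

variable {U : Set E} {G : E → E →L[ℝ] E →L[ℝ] ℝ} {ξ : E → E} {φ : E → E →L[ℝ] E}
  (h : IsLocalParacontact U G ξ φ)
include h

/-- Writing ∇φ through second derivatives of η reduces the cyclic identity for ∇φ to d(dη) = 0. -/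
theorem G_covEnd_φ {z : E} (hz : z ∈ U) (w u v : E) : G z u (covEnd G φ z w v) =
    1 / 2 * (fderiv ℝ (fderiv ℝ fun y ↦ G y (ξ y)) z w u v -
      fderiv ℝ (fderiv ℝ fun y ↦ G y (ξ y)) z w v u) - G z (christoffel G z w u) (φ z v)
      - G z u (φ z (christoffel G z w v)) := by
  have hGd := h.differentiableAt hz
  have hφ := h.differentiableAt_φ hz
  have hφv : DifferentiableAt ℝ (fun y ↦ φ y v) z := hφ.clm_apply (differentiableAt_const v)
  have hη : DifferentiableAt ℝ (fderiv ℝ fun y ↦ G y (ξ y)) z :=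
    differentiableAt_of_mem h.isOpen
      ((h.contDiffOn.clm_apply h.contDiffOn_ξ).fderiv_of_isOpen h.isOpen (by simp)) hz
  have e := congrArg (fun f ↦ f w)
    (fderiv_eq_of_eqOn h.isOpen (fun y hy ↦ h.dη_eq y hy u v) hz)
  have hη' : ∀ u, DifferentiableAt ℝ (fun x ↦ fderiv ℝ (fun y ↦ G y (ξ y)) x u) z := fun u ↦
    hη.clm_apply (differentiableAt_const u)
  have e1 : ∀ u v, fderiv ℝ (fun x ↦ fderiv ℝ (fun y ↦ G y (ξ y)) x u v) z w =
      fderiv ℝ (fderiv ℝ fun y ↦ G y (ξ y)) z w u v := fun u v ↦ by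
    rw [fderiv_end_apply (hη' u) (differentiableAt_const v),
      fderiv_end_apply hη (differentiableAt_const u)]
    simp
  have hd : ∀ u v, DifferentiableAt ℝ (fun x ↦ fderiv ℝ (fun y ↦ G y (ξ y)) x u v) z := fun u v ↦
    (hη' u).clm_apply (differentiableAt_const v)
  have e2 : fderiv ℝ (fun y ↦ G y u (φ y v)) z w =
      fderiv ℝ G z w u (φ z v) + G z u (fderiv ℝ φ z w v) := by
    rw [fderiv_bilin_apply hGd (differentiableAt_const u) hφv,
      fderiv_end_apply hφ (differentiableAt_const v)]
    simp
  simp only [fderiv_const_mul ((hd u v).fun_sub (hd v u)), fderiv_fun_sub (hd u v) (hd v u),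
    sub_apply, smul_apply, smul_eq_mul, e1, e2, h.toIsLocalMetric.fderiv_eq hz] at e
  simp only [covEnd_apply, map_add, map_sub]
  linarith

theorem ξ_covD {z : E} (hz : z ∈ U) (w : E) : G z (covD G ξ z w) (ξ z) = 0 := by
  have e := congrArg (fun f ↦ f w) (fderiv_eq_of_eqOn h.isOpen h.ξ_ξ hz)
  have hξ := h.differentiableAt_ξ hz
  simp only [h.toIsLocalMetric.fderiv_apply_eq hz hξ hξ, fderiv_fun_const, Pi.zero_apply,
    zero_apply] at e
  rw [h.symm z hz (ξ z)] at e
  linarith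

theorem covEnd_φ_φ {z : E} (hz : z ∈ U) (w u : E) :
    covEnd G φ z w (φ z u) + φ z (covEnd G φ z w u) =
      - (G z (covD G ξ z w) u • ξ z + G z (ξ z) u • covD G ξ z w) := by
  have hφ := h.differentiableAt_φ hz
  have hξ := h.differentiableAt_ξ hz
  have hφu : DifferentiableAt ℝ (fun y ↦ φ y u) z := hφ.clm_apply (differentiableAt_const u)
  have hη : DifferentiableAt ℝ (fun y ↦ G y (ξ y) u) z :=
    ((h.differentiableAt hz).clm_apply hξ).clm_apply (differentiableAt_const u)
  have e := congrArg (fun f ↦ f w) (fderiv_eq_of_eqOn h.isOpen (fun y hy ↦ h.φ_sq y hy u) hz)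
  have e1 : fderiv ℝ (fun y ↦ G y (ξ y) u) z w = G z (covD G ξ z w) u +
      G z (ξ z) (christoffel G z w u) := by
    rw [h.toIsLocalMetric.fderiv_apply_eq hz hξ (differentiableAt_const u)]
    simp
  have e2 : fderiv ℝ (fun y ↦ G y (ξ y) u • ξ y) z w =
      (G z (covD G ξ z w) u + G z (ξ z) (christoffel G z w u)) • ξ z +
        G z (ξ z) u • fderiv ℝ ξ z w := by
    rw [fderiv_fun_smul hη hξ, ← e1]
    simp [add_comm]
  have e3 : fderiv ℝ (fun y ↦ φ y (φ y u)) z w =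
      fderiv ℝ φ z w (φ z u) + φ z (fderiv ℝ φ z w u) := by
    rw [fderiv_end_apply hφ hφu, fderiv_end_apply hφ (differentiableAt_const u)]
    simp
  simp only [e3, fderiv_fun_sub (differentiableAt_const u) (hη.fun_smul hξ), e2,
    fderiv_fun_const, Pi.zero_apply, neg_apply, zero_sub] at e
  simp only [covEnd_apply, map_add, map_sub, h.φ_sq z hz, map_smul]
  rw [eq_sub_of_add_eq e]
  simp only [covD_apply, map_add, add_apply, add_smul, smul_add]
  abel

theorem paracontactAt {z : E} (hz : z ∈ U) :
    ParacontactAt (G z) (ξ z) (φ z) (covD G ξ z) (covEnd G φ z) where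
  symm := h.symm z hz
  φ_skew := h.φ_skew hz
  η_φ := h.dη_ξ z hz
  φ_sq := h.φ_sq z hz
  ξ_ξ := h.ξ_ξ z hz
  -- In `skew_covD` at (ξ, v), both g(∇_v ξ, ξ) and η(φ v) vanish, so ∇_ξ ξ is orthogonal to every
  -- v.
  A_ξ := h.nondegenerate z hz _ fun v ↦ by
    have := h.skew_covD hz (ξ z) v
    rwa [h.ξ_covD hz, h.dη_ξ z hz, sub_zero, mul_zero] at this
  ξ_A := h.ξ_covD hz
  P_skew w u v := by
    have h1 := h.skew_covEnd hz w u v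
    have h2 := h.skew_covEnd hz w v u
    linarith
  -- Second derivatives of η cancel by their symmetry; the Christoffel terms cancel in pairs by
  -- symmetry of Γ and skewness of φ.
  P_cyclic u v w := by
    have hη : ∀ u v, fderiv ℝ (fderiv ℝ fun y ↦ G y (ξ y)) z u v =
        fderiv ℝ (fderiv ℝ fun y ↦ G y (ξ y)) z v u := fun u v ↦
      (contDiffAt_of_mem h.isOpen (h.contDiffOn.clm_apply h.contDiffOn_ξ) hz).isSymmSndFDerivAt
        (by simpa using ENat.LEInfty.out) u v
    have hΓ := h.toIsLocalMetric.christoffel_symm hz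
    rw [h.G_covEnd_φ hz, h.G_covEnd_φ hz, h.G_covEnd_φ hz, hη u v, hη w u, hη v w, hΓ u v, hΓ w u,
      hΓ v w, h.φ_skew hz (christoffel G z v u), h.φ_skew hz (christoffel G z w v),
      h.φ_skew hz (christoffel G z u w)]
    ring
  P_φ := h.covEnd_φ_φ hz

/-- This is the derivative of div ξ = 0: the Christoffel terms form a commutator with ∇ξ, which has
trace zero. -/
theorem sum_covEnd_covD (b : Module.Basis ι ℝ E) {z : E} (hz : z ∈ U) (w : E) :
    ∑ i, G z (covEnd G (covD G ξ) z w (b i)) (dualFrame G b z i) = 0 := by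
  have hA : DifferentiableAt ℝ (covD G ξ) z := differentiableAt_of_mem h.isOpen
    (h.toIsLocalMetric.contDiffOn_covD h.contDiffOn_ξ) hz
  have h0 : ∀ y ∈ U, ∑ i, coordL b i (covD G ξ y (b i)) = 0 := fun y hy ↦ by
    simpa only [h.toIsLocalMetric.G_dualFrame b hy] using
      (h.paracontactAt hy).trace_A (h.toIsLocalMetric.isDualPair b hy)
  have e := congrArg (fun f ↦ f w) (fderiv_eq_of_eqOn h.isOpen h0 hz)
  have hi : ∀ i, HasFDerivAt (fun y ↦ coordL b i (covD G ξ y (b i)))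
      (coordL b i ∘L (fderiv ℝ (covD G ξ) z).flip (b i)) z := fun i ↦
    (coordL b i).hasFDerivAt.comp z (by
      simpa using hA.hasFDerivAt.clm_apply (hasFDerivAt_const (b i) z))
  have e1 : ∑ i, coordL b i (fderiv ℝ (covD G ξ) z w (b i)) = 0 := by
    rw [(HasFDerivAt.fun_sum fun i _ ↦ hi i).fderiv] at e
    simpa using e
  simp only [h.toIsLocalMetric.G_dualFrame b hz]
  simp only [covEnd_apply, map_add, map_sub]
  rw [Finset.sum_sub_distrib, Finset.sum_add_distrib, e1, zero_add,
    sum_coordL_comm b (christoffel G z w) (covD G ξ z), sub_self]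

/-- The rough Laplacian of the Reeb vector field is orthogonal to `w ⊥ ξ` if `ϱ(w, ξ) = 0`. -/
theorem sum_covEnd_eq_zero (b : Module.Basis ι ℝ E) {z : E} (hz : z ∈ U) {w : E}
    (hw : G z w (ξ z) = 0)
    (hric : ∑ i, G z (riemann G z w (b i) (ξ z)) (dualFrame G b z i) = 0) :
    ∑ i, G z (covEnd G (covD G ξ) z (b i) (dualFrame G b z i)) w = 0 := by
  refine (h.paracontactAt hz).sum_B (h.toIsLocalMetric.isDualPair b hz) (h.skew_covEnd hz)
    (h.sum_covEnd_covD b hz) hw (Eq.trans (Finset.sum_congr rfl fun i _ ↦ ?_) hric)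
  have := h.toIsLocalMetric.covEnd_covD hz
    ((contDiffAt_of_mem h.isOpen h.contDiffOn_ξ hz).of_le ENat.LEInfty.out) w (b i)
  rw [← neg_sub, this, neg_neg]

/-- The first variation density of the energy at the Reeb vector field is a divergence. -/
theorem density_mul_sum_eq [DecidableEq ι] (b : Module.Basis ι ℝ E) {Y : E → E}
    (hY : ContDiffOn ℝ ∞ Y U) {z : E} (hz : z ∈ U) (hYξ : G z (Y z) (ξ z) = 0)
    (hric : ∑ i, G z (riemann G z (Y z) (b i) (ξ z)) (dualFrame G b z i) = 0) :
    density G b z * ∑ i, G z (covD G ξ z (b i)) (covD G Y z (dualFrame G b z i)) =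
      ∑ j, fderiv ℝ (fun y ↦ density G b y * coordL b j (sharp G y (G y (Y y) ∘L covD G ξ y)))
        z (b j) := by
  have hA := h.toIsLocalMetric.contDiffOn_covD h.contDiffOn_ξ
  have hX : ContDiffOn ℝ ∞ (fun y ↦ sharp G y (G y (Y y) ∘L covD G ξ y)) U :=
    h.contDiffOn_sharp.clm_apply ((h.contDiffOn.clm_apply hY).clm_comp hA)
  have hXz := differentiableAt_of_mem h.isOpen hX hz
  have hbc := h.toIsLocalMetric.isDualPair b hz
  rw [h.toIsLocalMetric.sum_fderiv_density_mul b hz hXz]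
  simp only [← h.toIsLocalMetric.G_dualFrame b hz,
    h.toIsLocalMetric.G_covD_sharp hz (differentiableAt_of_mem h.isOpen hA hz)
      (differentiableAt_of_mem h.isOpen hY hz) hXz]
  -- The second part of the divergence is g(tr ∇²ξ, Y), which vanishes since Y ⊥ ξ and ϱ(Y, ξ) = 0.
  have e := h.sum_covEnd_eq_zero b hz hYξ hric
  simp only [h.symm z hz _ (Y z)] at e
  have hf : IsBilin fun u v ↦ G z (covD G ξ z u) (covD G Y z v) :=
    isBilin_clm ((G z).bilinearComp (covD G ξ z) (covD G Y z))
  rw [Finset.sum_add_distrib, e, add_zero, ← hbc.trace_swap (h.symm z hz) hf]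
  simp only [h.symm z hz (covD G ξ z _)]

end IsLocalParacontact

end LocalEulerLagrange

end Paracontact
end

noncomputable section

namespace Paracontact

/-! ### Vector fields and the metric in the coordinates of a chart. -/

section Chart

set_option maxSynthPendingDepth 3

variable {m : ℕ} {M : Type*} [TopologicalSpace M] [ChartedSpace (EuclideanSpace ℝ (Fin m)) M]

/-- The coordinate frame of the chart at `p`, at the point with coordinates `z`. -/
def frame (p : M) (z : EuclideanSpace ℝ (Fin m)) :
    EuclideanSpace ℝ (Fin m) →L[ℝ] TangentSpace (𝓡 m) ((extChartAt (𝓡 m) p).symm z) :=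
  mfderiv 𝓘(ℝ, EuclideanSpace ℝ (Fin m)) (𝓡 m) (extChartAt (𝓡 m) p).symm z

/-- The components of a tangent vector in the chart at `p`, at the point with coordinates `z`. -/
def coframe (p : M) (z : EuclideanSpace ℝ (Fin m)) :
    TangentSpace (𝓡 m) ((extChartAt (𝓡 m) p).symm z) →L[ℝ] EuclideanSpace ℝ (Fin m) :=
  mfderiv (𝓡 m) 𝓘(ℝ, EuclideanSpace ℝ (Fin m)) (extChartAt (𝓡 m) p)
    ((extChartAt (𝓡 m) p).symm z)

/-- The components of a vector field in the chart at `p`. -/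
def coordField (p : M) (Y : VField m M) (z : EuclideanSpace ℝ (Fin m)) :
    EuclideanSpace ℝ (Fin m) :=
  coframe p z (Y ((extChartAt (𝓡 m) p).symm z))

theorem isOpen_target (p : M) : IsOpen (extChartAt (𝓡 m) p).target :=
  isOpen_extChartAt_target p

variable [IsManifold (𝓡 m) ∞ M] {p : M} {z : EuclideanSpace ℝ (Fin m)}

theorem contMDiffOn_symm (p : M) : ContMDiffOn 𝓘(ℝ, EuclideanSpace ℝ (Fin m)) (𝓡 m) ∞
    (extChartAt (𝓡 m) p).symm (extChartAt (𝓡 m) p).target :=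
  contMDiffOn_extChartAt_symm p

theorem frame_coframe (hz : z ∈ (extChartAt (𝓡 m) p).target)
    (v : TangentSpace (𝓡 m) ((extChartAt (𝓡 m) p).symm z)) :
    frame p z (coframe p z v) = v := by
  have h := mfderivWithin_extChartAt_symm_comp_mfderiv_extChartAt (I := 𝓡 m) hz
  rw [ModelWithCorners.range_eq_univ, mfderivWithin_univ] at h
  exact congrArg (fun f ↦ f v) h

theorem coframe_frame (hz : z ∈ (extChartAt (𝓡 m) p).target) (u : EuclideanSpace ℝ (Fin m)) :
    coframe p z (frame p z u) = u := by
  have h := mfderiv_extChartAt_comp_mfderivWithin_extChartAt_symm (I := 𝓡 m) hz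
  rw [ModelWithCorners.range_eq_univ, mfderivWithin_univ] at h
  exact congrArg (fun f ↦ f u) h

theorem frame_coordField (hz : z ∈ (extChartAt (𝓡 m) p).target) (Y : VField m M) :
    frame p z (coordField p Y z) = Y ((extChartAt (𝓡 m) p).symm z) :=
  frame_coframe hz _

theorem inverse_frame (hz : z ∈ (extChartAt (𝓡 m) p).target)
    (v : TangentSpace (𝓡 m) ((extChartAt (𝓡 m) p).symm z)) :
    (frame p z).inverse v = coframe p z v := by
  have : frame p z = (ContinuousLinearEquiv.equivOfInverse (frame p z) (coframe p z)
    (coframe_frame hz) (frame_coframe hz) : _ →L[ℝ] _) := rfl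
  rw [this, ContinuousLinearMap.inverse_equiv]
  rfl

/-- The tangent bundle trivialization at `p` is the derivative of the chart, so smoothness of
sections can be tested on `coframe` components. -/
theorem trivializationAt_snd (hz : z ∈ (extChartAt (𝓡 m) p).target)
    (v : TangentSpace (𝓡 m) ((extChartAt (𝓡 m) p).symm z)) :
    (trivializationAt (EuclideanSpace ℝ (Fin m)) (TangentSpace (𝓡 m)) p
      ⟨(extChartAt (𝓡 m) p).symm z, v⟩).2 = coframe p z v := by
  have hy : (extChartAt (𝓡 m) p).symm z ∈ (chartAt (EuclideanSpace ℝ (Fin m)) p).source := by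
    rw [← extChartAt_source (𝓡 m)]
    exact (extChartAt (𝓡 m) p).map_target hz
  have h := TangentBundle.continuousLinearMapAt_trivializationAt (I := 𝓡 m) hy
  have h2 := congrArg (fun f ↦ f v) h
  refine Eq.trans ?_ h2
  rw [Bundle.Trivialization.continuousLinearMapAt_apply, Bundle.Trivialization.coe_linearMapAt_of_mem]
  exact hy

/-- The base map `b` is arbitrary so that the criterion covers both fields in a chart and
time-dependent families on ℝ × E. -/
theorem contMDiffOn_tangent_iff {F H N : Type*} [NormedAddCommGroup F] [NormedSpace ℝ F]
    [TopologicalSpace H] {I : ModelWithCorners ℝ F H} [TopologicalSpace N] [ChartedSpace H N]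
    {s : Set N} {b : N → EuclideanSpace ℝ (Fin m)}
    {v : (x : N) → TangentSpace (𝓡 m) ((extChartAt (𝓡 m) p).symm (b x))}
    (hb : ContMDiffOn I 𝓘(ℝ, EuclideanSpace ℝ (Fin m)) ∞ b s)
    (hbs : ∀ x ∈ s, b x ∈ (extChartAt (𝓡 m) p).target) :
    ContMDiffOn I (𝓡 m).tangent ∞
      (fun x ↦ (⟨(extChartAt (𝓡 m) p).symm (b x), v x⟩ : TangentBundle (𝓡 m) M)) s ↔
    ContMDiffOn I 𝓘(ℝ, EuclideanSpace ℝ (Fin m)) ∞ (fun x ↦ coframe p (b x) (v x)) s := by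
  have hm : Set.MapsTo
      (fun x ↦ (⟨(extChartAt (𝓡 m) p).symm (b x), v x⟩ : TangentBundle (𝓡 m) M)) s
      (trivializationAt (EuclideanSpace ℝ (Fin m)) (TangentSpace (𝓡 m)) p).source := fun x hx ↦ by
    rw [Bundle.Trivialization.mem_source]
    have := (extChartAt (𝓡 m) p).map_target (hbs x hx)
    rw [extChartAt_source] at this
    exact this
  rw [Bundle.Trivialization.contMDiffOn_iff hm]
  have h1 : ContMDiffOn I (𝓡 m) ∞ (fun x ↦ (extChartAt (𝓡 m) p).symm (b x)) s :=
    (contMDiffOn_symm p).comp hb hbs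
  simp only [h1, true_and]
  exact contMDiffOn_congr fun x hx ↦ trivializationAt_snd (hbs x hx) (v x)

theorem contMDiffOn_frame (p : M) (u : EuclideanSpace ℝ (Fin m)) :
    ContMDiffOn 𝓘(ℝ, EuclideanSpace ℝ (Fin m)) (𝓡 m).tangent ∞
      (fun z ↦ (⟨(extChartAt (𝓡 m) p).symm z, frame p z u⟩ : TangentBundle (𝓡 m) M))
      (extChartAt (𝓡 m) p).target := by
  refine (contMDiffOn_tangent_iff (b := fun z ↦ z) contMDiffOn_id fun x hx ↦ hx).2 ?_
  exact (contMDiffOn_const (c := u)).congr fun x hx ↦ coframe_frame hx u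

theorem contDiffOn_coordField {Y : VField m M} {s : Set (EuclideanSpace ℝ (Fin m))}
    (hs : s ⊆ (extChartAt (𝓡 m) p).target)
    (hY : ContMDiffOn (𝓡 m) (𝓡 m).tangent ∞ (fun x ↦ (⟨x, Y x⟩ : TangentBundle (𝓡 m) M))
      ((extChartAt (𝓡 m) p).symm '' s)) :
    ContDiffOn ℝ ∞ (coordField p Y) s := by
  rw [← contMDiffOn_iff_contDiffOn]
  exact (contMDiffOn_tangent_iff contMDiffOn_id hs).1
    (hY.comp ((contMDiffOn_symm p).mono hs) fun x hx ↦ ⟨x, hx, rfl⟩)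

theorem SmoothVField.contDiffOn {Y : VField m M} (hY : SmoothVField Y) (p : M) :
    ContDiffOn ℝ ∞ (coordField p Y) (extChartAt (𝓡 m) p).target :=
  contDiffOn_coordField le_rfl (ContMDiff.contMDiffOn hY)

namespace SemiRiemannianMetric

variable (g : SemiRiemannianMetric m M)

/-- The metric in the coordinates of the chart at `p`. -/
def coord (p : M) (z : EuclideanSpace ℝ (Fin m)) :
    EuclideanSpace ℝ (Fin m) →L[ℝ] EuclideanSpace ℝ (Fin m) →L[ℝ] ℝ :=
  (ContinuousLinearMap.precomp ℝ (frame p z)) ∘L (g.val _ ∘L frame p z)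

@[simp]
theorem coord_apply (p : M) (z u v : EuclideanSpace ℝ (Fin m)) :
    g.coord p z u v = g.val _ (frame p z u) (frame p z v) := rfl

theorem isLocalMetric (p : M) : IsLocalMetric (extChartAt (𝓡 m) p).target (g.coord p) where
  isOpen := isOpen_target p
  contDiffOn := by
    refine contDiffOn_clm_apply.2 fun u ↦ contDiffOn_clm_apply.2 fun v ↦ ?_
    have h := ContMDiffOn.clm_bundle_apply₂ (F₁ := EuclideanSpace ℝ (Fin m))
      (F₂ := EuclideanSpace ℝ (Fin m)) (F₃ := ℝ) (E₃ := Bundle.Trivial M ℝ)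
      (g.contMDiff.comp_contMDiffOn (contMDiffOn_symm p)) (contMDiffOn_frame p u)
      (contMDiffOn_frame p v)
    rw [← contMDiffOn_iff_contDiffOn]
    intro z hz
    exact (contMDiffWithinAt_totalSpace.1 (h z hz)).2
  symm z _ u v := g.symm _ _ _
  nondegenerate z hz u h := by
    have h0 : frame p z u = 0 := g.nondegenerate _ _ fun v ↦ by
      have := h (coframe p z v)
      rwa [coord_apply, frame_coframe hz] at this
    rw [← coframe_frame hz u, h0, map_zero]

end SemiRiemannianMetric

end Chart

end Paracontact
end

noncomputable section

namespace Paracontact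

/-! ### Lie bracket and Levi-Civita connection in a chart. -/

section ChartGeometry

set_option maxSynthPendingDepth 3

theorem mlieBracket_eq_lieBracket {E : Type*} [NormedAddCommGroup E] [NormedSpace ℝ E]
    (V W : (x : E) → TangentSpace 𝓘(ℝ, E) x) :
    VectorField.mlieBracket 𝓘(ℝ, E) V W = VectorField.lieBracket ℝ V W := by
  rw [← VectorField.mlieBracketWithin_univ, VectorField.mlieBracketWithin_eq_lieBracketWithin]
  exact VectorField.lieBracketWithin_univ

variable {m : ℕ} {M : Type*} [TopologicalSpace M] [ChartedSpace (EuclideanSpace ℝ (Fin m)) M]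

theorem symm_continuousAt {p : M} {z : EuclideanSpace ℝ (Fin m)}
    (hz : z ∈ (extChartAt (𝓡 m) p).target) : ContinuousAt (extChartAt (𝓡 m) p).symm z :=
  (continuousOn_extChartAt_symm p).continuousAt ((isOpen_target p).mem_nhds hz)

variable [IsManifold (𝓡 m) ∞ M] {p : M} {z : EuclideanSpace ℝ (Fin m)}

/-- `Y` is a vector field that is smooth near `x`. -/
def SmoothVFieldAt (Y : VField m M) (x : M) : Prop :=
  ContMDiffAt (𝓡 m) (𝓡 m).tangent ∞ (fun x ↦ (⟨x, Y x⟩ : TangentBundle (𝓡 m) M)) x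

/-- A pointwise criterion is needed because `ext v` is known to be smooth only near its base point.
-/
theorem smoothVFieldAt_iff (hz : z ∈ (extChartAt (𝓡 m) p).target) (Y : VField m M) :
    SmoothVFieldAt Y ((extChartAt (𝓡 m) p).symm z) ↔ ContDiffAt ℝ ∞ (coordField p Y) z := by
  set y := (extChartAt (𝓡 m) p).symm z with hy
  have hys : y ∈ (extChartAt (𝓡 m) p).source := (extChartAt (𝓡 m) p).map_target hz
  have hys' : y ∈ (chartAt (EuclideanSpace ℝ (Fin m)) p).source := by
    rwa [extChartAt_source] at hys
  have hsrc : (extChartAt (𝓡 m) p).source ∈ 𝓝 y := (isOpen_extChartAt_source p).mem_nhds hys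
  have hχy : extChartAt (𝓡 m) p y = z := (extChartAt (𝓡 m) p).right_inv hz
  have hm : (⟨y, Y y⟩ : TangentBundle (𝓡 m) M) ∈
      (trivializationAt (EuclideanSpace ℝ (Fin m)) (TangentSpace (𝓡 m)) p).source := by
    rw [Bundle.Trivialization.mem_source]
    exact hys'
  unfold SmoothVFieldAt
  rw [Bundle.Trivialization.contMDiffAt_iff
    (f := fun x ↦ (⟨x, Y x⟩ : TangentBundle (𝓡 m) M)) hm]
  have h1 : ContMDiffAt (𝓡 m) (𝓡 m) ∞ (fun x : M ↦ x) y := contMDiffAt_id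
  simp only [h1, true_and]
  have hev : (fun x ↦ (trivializationAt (EuclideanSpace ℝ (Fin m)) (TangentSpace (𝓡 m)) p
      ⟨x, Y x⟩).2) =ᶠ[𝓝 y] fun x ↦ coordField p Y (extChartAt (𝓡 m) p x) := by
    filter_upwards [hsrc] with x hx
    have hx' := (extChartAt (𝓡 m) p).map_source hx
    have := trivializationAt_snd hx' (Y ((extChartAt (𝓡 m) p).symm (extChartAt (𝓡 m) p x)))
    rw [coordField, ← this, (extChartAt (𝓡 m) p).left_inv hx]
  rw [hev.contMDiffAt_iff, ← contMDiffAt_iff_contDiffAt]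
  constructor
  · intro h
    have h2 := h.comp z ((contMDiffOn_symm p).contMDiffAt ((isOpen_target p).mem_nhds hz))
    refine h2.congr_of_eventuallyEq ?_
    filter_upwards [(isOpen_target p).mem_nhds hz] with w hw
    exact congrArg (coordField p Y) ((extChartAt (𝓡 m) p).right_inv hw).symm
  · intro h
    rw [← hχy] at h
    exact h.comp y (contMDiffAt_extChartAt' hys')

theorem SmoothVFieldAt.contDiffAt {Y : VField m M} (hz : z ∈ (extChartAt (𝓡 m) p).target)
    (hY : SmoothVFieldAt Y ((extChartAt (𝓡 m) p).symm z)) : ContDiffAt ℝ ∞ (coordField p Y) z :=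
  (smoothVFieldAt_iff hz Y).1 hY

theorem SmoothVFieldAt.differentiableAt {Y : VField m M} (hz : z ∈ (extChartAt (𝓡 m) p).target)
    (hY : SmoothVFieldAt Y ((extChartAt (𝓡 m) p).symm z)) :
    DifferentiableAt ℝ (coordField p Y) z :=
  (hY.contDiffAt hz).differentiableAt (by simp)

theorem SmoothVField.smoothVFieldAt {Y : VField m M} (hY : SmoothVField Y) (x : M) :
    SmoothVFieldAt Y x := ContMDiff.contMDiffAt hY

theorem smoothVFieldAt_ext {x : M} (v : TangentSpace (𝓡 m) x) : SmoothVFieldAt (ext v) x :=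
  FiberBundle.contMDiffAt_extend (𝓡 m) (EuclideanSpace ℝ (Fin m)) v

@[simp]
theorem ext_self {x : M} (v : TangentSpace (𝓡 m) x) : ext v x = v :=
  FiberBundle.extend_apply_self (EuclideanSpace ℝ (Fin m)) v

@[simp]
theorem coordField_ext (u : TangentSpace (𝓡 m) ((extChartAt (𝓡 m) p).symm z)) :
    coordField p (ext u) z = coframe p z u := by
  rw [coordField, ext_self]

theorem dirDeriv_eq (hz : z ∈ (extChartAt (𝓡 m) p).target) {f : M → ℝ}
    {f' : EuclideanSpace ℝ (Fin m) → ℝ}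
    (hff' : ∀ᶠ w in 𝓝 z, f ((extChartAt (𝓡 m) p).symm w) = f' w)
    (hf : DifferentiableAt ℝ f' z) (u : TangentSpace (𝓡 m) ((extChartAt (𝓡 m) p).symm z)) :
    dirDeriv f ((extChartAt (𝓡 m) p).symm z) u = fderiv ℝ f' z (coframe p z u) := by
  set y := (extChartAt (𝓡 m) p).symm z with hy
  have hys : y ∈ (extChartAt (𝓡 m) p).source := (extChartAt (𝓡 m) p).map_target hz
  have hys' : y ∈ (chartAt (EuclideanSpace ℝ (Fin m)) p).source := by
    rwa [extChartAt_source] at hys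
  have hχy : extChartAt (𝓡 m) p y = z := (extChartAt (𝓡 m) p).right_inv hz
  have hχ : HasMFDerivAt (𝓡 m) 𝓘(ℝ, EuclideanSpace ℝ (Fin m)) (extChartAt (𝓡 m) p) y
    (coframe p z) := (mdifferentiableAt_extChartAt hys').hasMFDerivAt
  have hf' : HasMFDerivAt 𝓘(ℝ, EuclideanSpace ℝ (Fin m)) 𝓘(ℝ, ℝ) f' (extChartAt (𝓡 m) p y)
      (fderiv ℝ f' z) := by
    rw [hχy]; exact hf.hasFDerivAt.hasMFDerivAt
  have hc := hf'.comp y hχ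
  have hev : f =ᶠ[𝓝 y] f' ∘ extChartAt (𝓡 m) p := by
    have hcont : Filter.Tendsto (extChartAt (𝓡 m) p) (𝓝 y) (𝓝 z) := by
      have := continuousAt_extChartAt' (I := 𝓡 m) hys
      rwa [ContinuousAt, hχy] at this
    filter_upwards [hcont.eventually hff', (isOpen_extChartAt_source p).mem_nhds hys] with x hx hx'
    rw [Function.comp_apply, ← hx, (extChartAt (𝓡 m) p).left_inv hx']
  have h := (hc.congr_of_eventuallyEq hev).mfderiv
  unfold dirDeriv mvfderiv
  rw [ContinuousLinearMap.comp_apply, h]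
  rfl

/-- Naturality of the Lie bracket under pullback by the inverse chart, which pulls fields back to
their coordinate fields near `z`. -/
theorem bracket_eq (hz : z ∈ (extChartAt (𝓡 m) p).target) {X Y : VField m M}
    (hX : SmoothVFieldAt X ((extChartAt (𝓡 m) p).symm z))
    (hY : SmoothVFieldAt Y ((extChartAt (𝓡 m) p).symm z)) :
    bracket X Y ((extChartAt (𝓡 m) p).symm z) =
      frame p z (VectorField.lieBracket ℝ (coordField p X) (coordField p Y) z) := by
  have hc := (contMDiffOn_symm p).contMDiffAt ((isOpen_target p).mem_nhds hz)
  have : IsManifold (𝓡 m) (minSmoothness ℝ 2) M := by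
    rw [minSmoothness_of_isRCLikeNormedField]
    exact IsManifold.of_le (n := ∞) ENat.LEInfty.out
  have h := VectorField.mpullback_mlieBracket (ContMDiffAt.mdifferentiableAt hX (by simp))
    (ContMDiffAt.mdifferentiableAt hY (by simp)) hc
    (by rw [minSmoothness_of_isRCLikeNormedField]; exact ENat.LEInfty.out)
  have hpull : ∀ X : VField m M, VectorField.mpullback 𝓘(ℝ, EuclideanSpace ℝ (Fin m)) (𝓡 m)
      (extChartAt (𝓡 m) p).symm X =ᶠ[𝓝 z] coordField p X := fun X ↦ by
    filter_upwards [(isOpen_target p).mem_nhds hz] with w hw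
    exact inverse_frame hw _
  have e : VectorField.mlieBracket 𝓘(ℝ, EuclideanSpace ℝ (Fin m)) (coordField p X)
      (coordField p Y) z = VectorField.lieBracket ℝ (coordField p X) (coordField p Y) z :=
    congrFun (mlieBracket_eq_lieBracket _ _) z
  rw [Filter.EventuallyEq.mlieBracket_vectorField_eq (hpull X) (hpull Y)] at h
  rw [← e, ← h]
  have := inverse_frame hz (VectorField.mlieBracket (𝓡 m) X Y ((extChartAt (𝓡 m) p).symm z))
  exact ((congrArg (frame p z) this).trans (frame_coframe hz _)).symm

theorem coframe_bracket (hz : z ∈ (extChartAt (𝓡 m) p).target) {X Y : VField m M}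
    (hX : SmoothVFieldAt X ((extChartAt (𝓡 m) p).symm z))
    (hY : SmoothVFieldAt Y ((extChartAt (𝓡 m) p).symm z)) :
    coframe p z (bracket X Y ((extChartAt (𝓡 m) p).symm z)) =
      VectorField.lieBracket ℝ (coordField p X) (coordField p Y) z := by
  rw [bracket_eq hz hX hY, coframe_frame hz]

namespace SemiRiemannianMetric

variable (g : SemiRiemannianMetric m M)

theorem sum_dualBasis (x : M) (v : TangentSpace (𝓡 m) x) :
    ∑ i, g.val x v (tangentBasis x i) • g.dualBasis x i = v := by
  have h := (g.dualBasis x).sum_repr v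
  simp only [dualBasis, LinearMap.BilinForm.dualBasis_repr_apply] at h
  exact h

theorem sum_tangentBasis (x : M) (v : TangentSpace (𝓡 m) x) :
    ∑ i, g.val x v (g.dualBasis x i) • tangentBasis x i = v := by
  have hs : (g.bilin x).IsSymm := ⟨fun u v ↦ g.symm x u v⟩
  have e := LinearMap.BilinForm.dualBasis_dualBasis (g.bilin_nondegenerate x) hs (tangentBasis x)
  have h := (tangentBasis x).sum_repr v
  rw [← e] at h
  simp only [LinearMap.BilinForm.dualBasis_repr_apply] at h
  rw [e] at h
  exact h

theorem coord_coframe (hz : z ∈ (extChartAt (𝓡 m) p).target)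
    (u v : TangentSpace (𝓡 m) ((extChartAt (𝓡 m) p).symm z)) :
    g.coord p z (coframe p z u) (coframe p z v) = g.val _ u v := by
  rw [coord_apply, frame_coframe hz, frame_coframe hz]

theorem isDualPair_coframe (hz : z ∈ (extChartAt (𝓡 m) p).target) :
    IsDualPair (g.coord p z)
      (fun i ↦ coframe p z (tangentBasis ((extChartAt (𝓡 m) p).symm z) i))
      (fun i ↦ coframe p z (g.dualBasis ((extChartAt (𝓡 m) p).symm z) i)) where
  left v := by
    have h := congrArg (coframe p z) (g.sum_tangentBasis _ (frame p z v))
    rw [coframe_frame hz, map_sum] at h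
    simpa only [map_smul, ← g.coord_coframe hz, coframe_frame hz] using h
  right v := by
    have h := congrArg (coframe p z) (g.sum_dualBasis _ (frame p z v))
    rw [coframe_frame hz, map_sum] at h
    simpa only [map_smul, ← g.coord_coframe hz, coframe_frame hz] using h

theorem dirDeriv_val (hz : z ∈ (extChartAt (𝓡 m) p).target) {X Y : VField m M}
    (hX : SmoothVFieldAt X ((extChartAt (𝓡 m) p).symm z))
    (hY : SmoothVFieldAt Y ((extChartAt (𝓡 m) p).symm z))
    (u : TangentSpace (𝓡 m) ((extChartAt (𝓡 m) p).symm z)) :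
    dirDeriv (fun y ↦ g.val y (X y) (Y y)) ((extChartAt (𝓡 m) p).symm z) u =
      g.coord p z (covD (g.coord p) (coordField p X) z (coframe p z u)) (coordField p Y z) +
      g.coord p z (coordField p X z) (covD (g.coord p) (coordField p Y) z (coframe p z u)) := by
  have hGd := (g.isLocalMetric p).differentiableAt hz
  have hXd := hX.differentiableAt hz
  have hYd := hY.differentiableAt hz
  rw [dirDeriv_eq hz (f' := fun w ↦ g.coord p w (coordField p X w) (coordField p Y w)) _
    ((hGd.clm_apply hXd).clm_apply hYd), (g.isLocalMetric p).fderiv_apply_eq hz hXd hYd]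
  filter_upwards [(isOpen_target p).mem_nhds hz] with w hw
  exact (g.coord_coframe hw _ _).symm

/-- The Koszul formula in coordinates. -/
theorem koszul_eq (hz : z ∈ (extChartAt (𝓡 m) p).target) {X Y Z : VField m M}
    (hX : SmoothVFieldAt X ((extChartAt (𝓡 m) p).symm z))
    (hY : SmoothVFieldAt Y ((extChartAt (𝓡 m) p).symm z))
    (hZ : SmoothVFieldAt Z ((extChartAt (𝓡 m) p).symm z)) :
    g.koszul X Y Z ((extChartAt (𝓡 m) p).symm z) =
      2 * g.coord p z (covD (g.coord p) (coordField p Y) z (coordField p X z))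
        (coordField p Z z) := by
  -- Torsion-freeness, [X, Y] = ∇_X Y - ∇_Y X. With it and metric compatibility, everything in the
  -- Koszul expression except 2 g(∇_X Y, Z) cancels.
  have hbr : ∀ {X Y : VField m M}, SmoothVFieldAt X ((extChartAt (𝓡 m) p).symm z) →
      SmoothVFieldAt Y ((extChartAt (𝓡 m) p).symm z) →
      ∀ v : TangentSpace (𝓡 m) ((extChartAt (𝓡 m) p).symm z),
      g.val _ (bracket X Y ((extChartAt (𝓡 m) p).symm z)) v =
        g.coord p z (covD (g.coord p) (coordField p Y) z (coordField p X z)) (coframe p z v) -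
        g.coord p z (covD (g.coord p) (coordField p X) z (coordField p Y z)) (coframe p z v) := by
    intro X Y hX hY v
    rw [← g.coord_coframe hz, coframe_bracket hz hX hY, VectorField.lieBracket_eq,
      covD_apply, covD_apply, (g.isLocalMetric p).christoffel_symm hz (coordField p X z)]
    simp only [map_add, map_sub, add_apply, sub_apply]
    ring
  have hs := (g.isLocalMetric p).symm z hz
  unfold koszul
  rw [g.dirDeriv_val hz hY hZ, g.dirDeriv_val hz hX hZ, g.dirDeriv_val hz hX hY, hbr hX hY,
    hbr hX hZ, hbr hY hZ]
  simp only [← coordField.eq_1]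
  rw [hs (coordField p Y z), hs (coordField p X z), hs (coordField p X z)]
  ring

/-- The Levi-Civita connection in coordinates. -/
theorem coframe_nabla (hz : z ∈ (extChartAt (𝓡 m) p).target) {Y : VField m M}
    (hY : SmoothVFieldAt Y ((extChartAt (𝓡 m) p).symm z))
    (u : TangentSpace (𝓡 m) ((extChartAt (𝓡 m) p).symm z)) :
    coframe p z (g.nabla Y ((extChartAt (𝓡 m) p).symm z) u) =
      covD (g.coord p) (coordField p Y) z (coframe p z u) := by
  unfold nabla
  rw [map_sum]
  simp only [map_smul, g.koszul_eq hz (smoothVFieldAt_ext _) hY (smoothVFieldAt_ext _),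
    coordField_ext]
  refine Eq.trans ?_ ((g.isDualPair_coframe hz).right _)
  refine Finset.sum_congr rfl fun i _ ↦ ?_
  rw [← mul_assoc]
  norm_num

end SemiRiemannianMetric

end ChartGeometry

end Paracontact
end

noncomputable section

namespace Paracontact

/-! ### Curvature, Ricci tensor and energy density in a chart. -/

section ChartCurvature

set_option maxSynthPendingDepth 3

variable {m : ℕ} {M : Type*} [TopologicalSpace M] [ChartedSpace (EuclideanSpace ℝ (Fin m)) M]

/-- The standard basis. -/
abbrev stdBasis (m : ℕ) : Module.Basis (Fin m) ℝ (EuclideanSpace ℝ (Fin m)) :=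
  (EuclideanSpace.basisFun (Fin m) ℝ).toBasis

theorem covD_congr {E : Type*} [NormedAddCommGroup E] [NormedSpace ℝ E]
    {G : E → E →L[ℝ] E →L[ℝ] ℝ} {X Y : E → E} {z : E} (h : X =ᶠ[𝓝 z] Y) :
    covD G X z = covD G Y z := by
  rw [covD, covD, h.fderiv_eq, h.eq_of_nhds]

variable [IsManifold (𝓡 m) ∞ M] {p : M} {z : EuclideanSpace ℝ (Fin m)}

theorem eventually_smoothVFieldAt_ext {x : M} (v : TangentSpace (𝓡 m) x) :
    ∀ᶠ y in 𝓝 x, SmoothVFieldAt (ext v) y := by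
  obtain ⟨u, hu, h⟩ := FiberBundle.exists_contMDiffOn_extend (𝓡 m) (EuclideanSpace ℝ (Fin m))
    (k := ∞) v
  filter_upwards [eventually_mem_nhds_iff.2 hu] with y hy
  exact h.contMDiffAt hy

namespace SemiRiemannianMetric

variable (g : SemiRiemannianMetric m M)

theorem coordField_nablaField (hz : z ∈ (extChartAt (𝓡 m) p).target) (X : VField m M)
    {Y : VField m M} (hY : SmoothVFieldAt Y ((extChartAt (𝓡 m) p).symm z)) :
    coordField p (g.nablaField X Y) z =
      covD (g.coord p) (coordField p Y) z (coordField p X z) :=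
  g.coframe_nabla hz hY _

/-- The inner covariant derivatives are differentiated again, so their coordinate form is needed on
a neighbourhood of `z` (`hev`); this uses that `ext w` is smooth near its base point and not only at
it. -/
theorem coframe_curvature (hz : z ∈ (extChartAt (𝓡 m) p).target)
    (u v w : TangentSpace (𝓡 m) ((extChartAt (𝓡 m) p).symm z)) :
    coframe p z (g.curvature ((extChartAt (𝓡 m) p).symm z) u v w) =
      riemann (g.coord p) z (coframe p z u) (coframe p z v) (coframe p z w) := by
  have hG := g.isLocalMetric p
  have hw := smoothVFieldAt_ext w
  have hev : ∀ v : TangentSpace (𝓡 m) ((extChartAt (𝓡 m) p).symm z),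
      coordField p (g.nablaField (ext v) (ext w)) =ᶠ[𝓝 z]
        fun y ↦ covD (g.coord p) (coordField p (ext w)) y (coordField p (ext v) y) := by
    intro v
    filter_upwards [(isOpen_target p).mem_nhds hz,
      (symm_continuousAt hz).eventually (eventually_smoothVFieldAt_ext w)] with y hy hy'
    exact g.coordField_nablaField hy _ hy'
  have hN : ∀ v : TangentSpace (𝓡 m) ((extChartAt (𝓡 m) p).symm z),
      SmoothVFieldAt (g.nablaField (ext v) (ext w)) ((extChartAt (𝓡 m) p).symm z) := by
    intro v
    rw [smoothVFieldAt_iff hz]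
    refine ContDiffAt.congr_of_eventuallyEq ?_ (hev v)
    exact (hG.contDiffAt_covD hz (hw.contDiffAt hz)).clm_apply
      ((smoothVFieldAt_ext v).contDiffAt hz)
  have e := hG.covD_lieBracket hz ((smoothVFieldAt_ext u).differentiableAt hz)
    ((smoothVFieldAt_ext v).differentiableAt hz)
    ((hw.contDiffAt hz).of_le (m := 2) ENat.LEInfty.out)
  simp only [coordField_ext] at e
  change coframe p z (g.nabla (ext w) _ (bracket (ext u) (ext v) _) -
    (g.nabla (g.nablaField (ext v) (ext w)) _ (ext u _) -
      g.nabla (g.nablaField (ext u) (ext w)) _ (ext v _))) = _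
  rw [map_sub, map_sub, g.coframe_nabla hz hw, g.coframe_nabla hz (hN v),
    g.coframe_nabla hz (hN u), coframe_bracket hz (smoothVFieldAt_ext u) (smoothVFieldAt_ext v),
    covD_congr (hev u), covD_congr (hev v), ext_self, ext_self, e]

/-- The Ricci tensor in coordinates. -/
def coordRicci (p : M) (z u w : EuclideanSpace ℝ (Fin m)) : ℝ :=
  ∑ i, g.coord p z (riemann (g.coord p) z u (stdBasis m i) w)
    (dualFrame (g.coord p) (stdBasis m) z i)

/-- `tangentBasis` need not be the coordinate frame of the chart at `p`; independence of the trace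
from the dual pair bridges the gap. -/
theorem ricci_eq (hz : z ∈ (extChartAt (𝓡 m) p).target)
    (u w : TangentSpace (𝓡 m) ((extChartAt (𝓡 m) p).symm z)) :
    g.ricci ((extChartAt (𝓡 m) p).symm z) u w =
      g.coordRicci p z (coframe p z u) (coframe p z w) := by
  have hG := g.isLocalMetric p
  have hf : IsBilin fun v v' ↦
      g.coord p z (riemann (g.coord p) z (coframe p z u) v (coframe p z w)) v' := by
    refine ⟨fun v' ↦ ⟨fun v₁ v₂ ↦ ?_, fun c v ↦ ?_⟩, fun v ↦
      ⟨fun _ _ ↦ map_add _ _ _, fun _ _ ↦ map_smul _ _ _⟩⟩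
    · simp only [riemann, map_add, map_sub, map_neg, add_apply, sub_apply, neg_apply]
      ring
    · simp only [riemann, map_add, map_sub, map_neg, map_smul, add_apply, sub_apply, neg_apply,
        smul_apply, smul_eq_mul]
      ring
  unfold ricci
  simp only [← g.coord_coframe hz, g.coframe_curvature hz]
  exact (g.isDualPair_coframe hz).trace_eq (hG.symm z hz) (hG.isDualPair (stdBasis m) hz) hf

theorem coordRicci_eq (hz : z ∈ (extChartAt (𝓡 m) p).target)
    (u w : TangentSpace (𝓡 m) ((extChartAt (𝓡 m) p).symm z)) :
    g.coordRicci p z (coframe p z u) (coframe p z w) =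
      g.val _ (g.ricciOp ((extChartAt (𝓡 m) p).symm z) u) w := by
  have hlin : IsLinearMap ℝ (g.coordRicci p z (coframe p z u)) := by
    refine ⟨fun v₁ v₂ ↦ ?_, fun c v ↦ ?_⟩
    · simp only [coordRicci, ← Finset.sum_add_distrib]
      refine Finset.sum_congr rfl fun i _ ↦ ?_
      simp only [riemann, map_add, map_sub, map_neg, add_apply, sub_apply, neg_apply]
      ring
    · simp only [coordRicci, smul_eq_mul, Finset.mul_sum]
      refine Finset.sum_congr rfl fun i _ ↦ ?_
      simp only [riemann, map_add, map_sub, map_neg, map_smul, add_apply, sub_apply, neg_apply,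
        smul_apply, smul_eq_mul]
      ring
  have hpair := g.isDualPair_coframe hz
  conv_lhs => rw [← hpair.left (coframe p z w)]
  have e := map_sum (hlin.mk' _) (fun i ↦ g.coord p z (coframe p z w)
    (coframe p z (g.dualBasis _ i)) • coframe p z (tangentBasis ((extChartAt (𝓡 m) p).symm z) i))
    Finset.univ
  simp only [IsLinearMap.mk'_apply, hlin.map_smul] at e
  rw [e]
  unfold ricciOp
  rw [map_sum, sum_apply]
  refine Finset.sum_congr rfl fun i _ ↦ ?_
  rw [map_smul, smul_apply, g.ricci_eq hz, g.coord_coframe hz, smul_eq_mul, smul_eq_mul, mul_comm,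
    g.symm _ w]

/-- The polarization of the energy density. -/
def energyPairing (V Y : VField m M) (x : M) : ℝ :=
  ∑ i, g.val x (g.nabla V x (tangentBasis x i)) (g.nabla Y x (g.dualBasis x i))

theorem energyPairing_eq (hz : z ∈ (extChartAt (𝓡 m) p).target) {V Y : VField m M}
    (hV : SmoothVFieldAt V ((extChartAt (𝓡 m) p).symm z))
    (hY : SmoothVFieldAt Y ((extChartAt (𝓡 m) p).symm z)) :
    g.energyPairing V Y ((extChartAt (𝓡 m) p).symm z) =
      ∑ i, g.coord p z (covD (g.coord p) (coordField p V) z (stdBasis m i))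
        (covD (g.coord p) (coordField p Y) z (dualFrame (g.coord p) (stdBasis m) z i)) := by
  have hG := g.isLocalMetric p
  have hf : IsBilin fun u v ↦ g.coord p z (covD (g.coord p) (coordField p V) z u)
      (covD (g.coord p) (coordField p Y) z v) :=
    isBilin_clm ((g.coord p z).bilinearComp (covD (g.coord p) (coordField p V) z)
      (covD (g.coord p) (coordField p Y) z))
  unfold energyPairing
  simp only [← g.coord_coframe hz, g.coframe_nabla hz hV, g.coframe_nabla hz hY]
  exact (g.isDualPair_coframe hz).trace_eq (hG.symm z hz) (hG.isDualPair (stdBasis m) hz) hf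

/-- The horizontal part of the Sasaki metric has trace m, so only the vertical part varies with the
field. -/
theorem energyDensity_eq_energyPairing (V : VField m M) (x : M) :
    g.energyDensity V x = 1 / 2 * (m + g.energyPairing V V x) := by
  unfold energyDensity sasakiPullback energyPairing
  rw [Finset.sum_add_distrib]
  congr 2
  have h : ∀ i, g.val x (tangentBasis x i) (g.dualBasis x i) = 1 := fun i ↦ by
    rw [g.symm]
    have := LinearMap.BilinForm.apply_dualBasis_left (B := g.bilin x) (g.bilin_nondegenerate x)
      (tangentBasis x) i i
    rwa [if_pos rfl] at this
  simp [h]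

end SemiRiemannianMetric

end ChartCurvature

/-! ### The paracontact structure in a chart. -/

section ChartParacontact

set_option maxSynthPendingDepth 3

variable {n : ℕ} {M : Type*} [TopologicalSpace M]
  [ChartedSpace (EuclideanSpace ℝ (Fin (2 * n + 1))) M] [IsManifold (𝓡 (2 * n + 1)) ∞ M]

namespace ParacontactMetricStructure

variable (S : ParacontactMetricStructure n M) {p : M} {z : EuclideanSpace ℝ (Fin (2 * n + 1))}

/-- The structure tensor in the coordinates of the chart at `p`. -/
def coordφ (p : M) (z : EuclideanSpace ℝ (Fin (2 * n + 1))) :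
    EuclideanSpace ℝ (Fin (2 * n + 1)) →L[ℝ] EuclideanSpace ℝ (Fin (2 * n + 1)) :=
  coframe p z ∘L S.φ _ ∘L frame p z

theorem coordφ_apply (p : M) (z u : EuclideanSpace ℝ (Fin (2 * n + 1))) :
    S.coordφ p z u = coframe p z (S.φ _ (frame p z u)) := rfl

theorem contDiffOn_coordφ (p : M) :
    ContDiffOn ℝ ∞ (S.coordφ p) (extChartAt (𝓡 (2 * n + 1)) p).target := by
  refine contDiffOn_clm_apply.2 fun u ↦ ?_
  have h := ContMDiffOn.clm_bundle_apply (F₁ := EuclideanSpace ℝ (Fin (2 * n + 1)))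
    (F₂ := EuclideanSpace ℝ (Fin (2 * n + 1)))
    (S.smooth_φ.comp_contMDiffOn (contMDiffOn_symm p)) (contMDiffOn_frame p u)
  rw [← contMDiffOn_iff_contDiffOn]
  exact (contMDiffOn_tangent_iff (b := fun z ↦ z) contMDiffOn_id fun x hx ↦ hx).1 h

/-- The derivatives of the extensions of `u` and `v` cancel against their bracket, leaving an
expression in ∇ξ that is tensorial in `u` and `v`. -/
theorem extDeriv₁_η_eq (hz : z ∈ (extChartAt (𝓡 (2 * n + 1)) p).target)
    (u v : TangentSpace (𝓡 (2 * n + 1)) ((extChartAt (𝓡 (2 * n + 1)) p).symm z)) :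
    extDeriv₁ S.η ((extChartAt (𝓡 (2 * n + 1)) p).symm z) u v =
      1 / 2 * (S.g.coord p z (covD (S.g.coord p) (coordField p S.ξ) z (coframe p z u))
        (coframe p z v) - S.g.coord p z (covD (S.g.coord p) (coordField p S.ξ) z (coframe p z v))
        (coframe p z u)) := by
  have hξ := S.smooth_ξ.smoothVFieldAt ((extChartAt (𝓡 (2 * n + 1)) p).symm z)
  unfold extDeriv₁
  simp only [S.η_eq]
  rw [S.g.dirDeriv_val hz hξ (smoothVFieldAt_ext v), S.g.dirDeriv_val hz hξ (smoothVFieldAt_ext u),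
    ← S.g.coord_coframe hz, coframe_bracket hz (smoothVFieldAt_ext u) (smoothVFieldAt_ext v),
    VectorField.lieBracket_eq]
  simp only [coordField_ext, covD_apply, map_add, map_sub, add_apply,
    (S.g.isLocalMetric p).christoffel_symm hz (coframe p z u) (coframe p z v)]
  simp only [coordField]
  ring

theorem isLocalParacontact (p : M) : IsLocalParacontact (extChartAt (𝓡 (2 * n + 1)) p).target
    (S.g.coord p) (coordField p S.ξ) (S.coordφ p) where
  toIsLocalMetric := S.g.isLocalMetric p
  contDiffOn_ξ := S.smooth_ξ.contDiffOn p
  contDiffOn_φ := S.contDiffOn_coordφ p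
  ξ_ξ z hz := by
    rw [coordField, S.g.coord_coframe hz, ← S.η_eq, S.η_ξ]
  dη_eq z hz u v := by
    have hξ := (S.smooth_ξ.smoothVFieldAt ((extChartAt (𝓡 (2 * n + 1)) p).symm z)).differentiableAt
      hz
    have hG := S.g.isLocalMetric p
    have e := S.extDeriv₁_η_eq hz (frame p z u) (frame p z v)
    rw [S.dη_eq, ← S.g.coord_coframe hz, coframe_frame hz, coframe_frame hz] at e
    rw [hG.fderiv_flat hz hξ, hG.fderiv_flat hz hξ, hG.christoffel_symm hz v u, coordφ_apply, e]
    ring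
  dη_ξ z hz u := by
    rw [coordφ_apply, coordField, S.g.coord_coframe hz, ← S.dη_eq, S.dη_ξ]
  φ_sq z hz u := by
    rw [coordφ_apply, coordφ_apply, frame_coframe hz, S.φ_sq, map_sub, coframe_frame hz, map_smul,
      S.η_eq, ← S.g.coord_coframe hz, coframe_frame hz]
    rfl

theorem g_ξ_ξ (x : M) : S.g.val x (S.ξ x) (S.ξ x) = 1 := by rw [← S.η_eq, S.η_ξ]

/-- The point where the η-Einstein condition enters: for Y ⊥ ξ, ϱ(Y, ξ) = g(QY, ξ) = a g(Y, ξ) = 0.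
-/
theorem IsEtaEinstein.coordRicci_eq_zero (hS : S.IsEtaEinstein)
    (hz : z ∈ (extChartAt (𝓡 (2 * n + 1)) p).target) {Y : EuclideanSpace ℝ (Fin (2 * n + 1))}
    (hY : S.g.coord p z Y (coordField p S.ξ z) = 0) :
    S.g.coordRicci p z Y (coordField p S.ξ z) = 0 := by
  obtain ⟨a, b, -, -, h⟩ := hS
  rw [← coframe_frame hz Y, coordField, S.g.coord_coframe hz] at hY
  rw [← coframe_frame hz Y, coordField, S.g.coordRicci_eq hz, h, S.η_eq, S.g.symm _ (S.ξ _), hY,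
    mul_zero, zero_smul, add_zero, map_smul, smul_apply, hY, smul_zero]

end ParacontactMetricStructure

end ChartParacontact

end Paracontact
end

noncomputable section

namespace Paracontact

/-! ### The volume measure and its description in charts. -/

section Volume

set_option maxSynthPendingDepth 3

/-- The Gram matrix becomes DᵀGD, so its determinant gains (det D)², whose root is the Jacobian
factor of the change of variables formula. -/
theorem density_eq_abs_det_mul {E ι : Type*} [NormedAddCommGroup E] [NormedSpace ℝ E]
    [Fintype ι] [DecidableEq ι] (b : Module.Basis ι ℝ E)
    {G G' : E → E →L[ℝ] E →L[ℝ] ℝ} {z z' : E} (D : E →L[ℝ] E)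
    (h : ∀ u v, G' z' u v = G z (D u) (D v)) :
    density G' b z' = |D.det| * density G b z := by
  have hN : gram G' b z' = (LinearMap.toMatrix b b D).transpose * gram G b z *
      LinearMap.toMatrix b b D := by
    ext i j
    have e1 := (isBilin_clm (G z)).sum_fst (b.repr (D (b i))) b (D (b j))
    have e2 := fun k ↦ (isBilin_clm (G z)).sum_snd (b.repr (D (b j))) b (b k)
    simp only [b.sum_repr] at e1 e2
    simp only [gram, Matrix.of_apply, h, e1, e2, Matrix.mul_apply, Matrix.transpose_apply,
      LinearMap.toMatrix_apply, ContinuousLinearMap.coe_coe, Finset.sum_mul, Finset.mul_sum]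
    rw [Finset.sum_comm]
    exact Finset.sum_congr rfl fun k _ ↦ Finset.sum_congr rfl fun l _ ↦ by ring
  have hdet : (gram G' b z').det = D.det ^ 2 * (gram G b z).det := by
    rw [hN, Matrix.det_mul, Matrix.det_mul, Matrix.det_transpose, LinearMap.det_toMatrix,
      ContinuousLinearMap.det]
    ring
  rw [density, density, hdet, abs_mul, Real.sqrt_mul (abs_nonneg _), abs_pow, Real.sqrt_sq_eq_abs,
    abs_abs]

variable {m : ℕ} {M : Type*} [TopologicalSpace M] [ChartedSpace (EuclideanSpace ℝ (Fin m)) M]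
  [IsManifold (𝓡 m) ∞ M]

namespace SemiRiemannianMetric

variable (g : SemiRiemannianMetric m M)

/-- The density of the volume measure in the chart at `p`. -/
def volDensity (p : M) (z : EuclideanSpace ℝ (Fin m)) : ℝ := density (g.coord p) (stdBasis m) z

theorem volDensity_nonneg (p : M) (z : EuclideanSpace ℝ (Fin m)) : 0 ≤ g.volDensity p z :=
  Real.sqrt_nonneg _

theorem coordMetric_eq (p : M) (z : EuclideanSpace ℝ (Fin m)) :
    g.coordMetric p z = gram (g.coord p) (stdBasis m) z := by
  ext i j
  simp only [coordMetric, gram, Matrix.of_apply, coord_apply, OrthonormalBasis.coe_toBasis,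
    EuclideanSpace.basisFun_apply]
  rfl

theorem continuousOn_volDensity (p : M) :
    ContinuousOn (g.volDensity p) (extChartAt (𝓡 m) p).target :=
  ((g.isLocalMetric p).contDiffOn_density (stdBasis m)).continuousOn

theorem coord_extChartAt {p y : M} (hy : y ∈ (extChartAt (𝓡 m) p).source)
    (v w : TangentSpace (𝓡 m) y) :
    g.coord p (extChartAt (𝓡 m) p y)
      (mfderiv (𝓡 m) 𝓘(ℝ, EuclideanSpace ℝ (Fin m)) (extChartAt (𝓡 m) p) y v)
      (mfderiv (𝓡 m) 𝓘(ℝ, EuclideanSpace ℝ (Fin m)) (extChartAt (𝓡 m) p) y w) = g.val y v w := by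
  obtain ⟨z, hz, rfl⟩ : ∃ z ∈ (extChartAt (𝓡 m) p).target, (extChartAt (𝓡 m) p).symm z = y :=
    ⟨_, (extChartAt (𝓡 m) p).map_source hy, (extChartAt (𝓡 m) p).left_inv hy⟩
  rw [show g.coord p (extChartAt (𝓡 m) p ((extChartAt (𝓡 m) p).symm z)) = g.coord p z from
    congrArg _ ((extChartAt (𝓡 m) p).right_inv hz)]
  exact g.coord_coframe hz v w

theorem volDensity_overlap {p q : M} {z : EuclideanSpace ℝ (Fin m)}
    (hz : z ∈ (extChartAt (𝓡 m) q).target)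
    (hzp : (extChartAt (𝓡 m) q).symm z ∈ (extChartAt (𝓡 m) p).source) :
    ∃ D : EuclideanSpace ℝ (Fin m) →L[ℝ] EuclideanSpace ℝ (Fin m),
      HasFDerivAt (fun w ↦ extChartAt (𝓡 m) p ((extChartAt (𝓡 m) q).symm w)) D z ∧
      g.volDensity q z = |D.det| *
        g.volDensity p (extChartAt (𝓡 m) p ((extChartAt (𝓡 m) q).symm z)) := by
  have h1 : HasMFDerivAt 𝓘(ℝ, EuclideanSpace ℝ (Fin m)) (𝓡 m) (extChartAt (𝓡 m) q).symm z
      (frame q z) :=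
    (((contMDiffOn_symm q).contMDiffAt ((isOpen_target q).mem_nhds hz)).mdifferentiableAt
      (by simp)).hasMFDerivAt
  have hzp' := hzp
  rw [extChartAt_source] at hzp'
  have h2 := (mdifferentiableAt_extChartAt (I := 𝓡 m) hzp').hasMFDerivAt
  have h3 := (h2.comp z h1).hasFDerivAt
  exact ⟨_, h3, density_eq_abs_det_mul _ _ fun u v ↦ (g.coord_extChartAt hzp _ _).symm⟩

variable [MeasurableSpace M] [BorelSpace M]

omit [IsManifold (𝓡 m) ∞ M] in
theorem measurableSet_chart_preimage (p : M) {s : Set M} (hs : MeasurableSet s) :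
    MeasurableSet ((extChartAt (𝓡 m) p).target ∩ (extChartAt (𝓡 m) p).symm ⁻¹' s) := by
  have h := (continuousOn_iff_continuous_domRestrict.1
    (continuousOn_extChartAt_symm (I := 𝓡 m) p)).measurable
  have h2 := (isOpen_target p).measurableSet.subtype_image (h hs)
  convert h2 using 1
  ext z
  simp [and_comm]

omit [IsManifold (𝓡 m) ∞ M] in
theorem aemeasurable_symm (p : M) : AEMeasurable (extChartAt (𝓡 m) p).symm
    ((volume : Measure (EuclideanSpace ℝ (Fin m))).restrict (extChartAt (𝓡 m) p).target) :=
  (continuousOn_extChartAt_symm p).aemeasurable (isOpen_target p).measurableSet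

omit [BorelSpace M] in
theorem chartVolume_eq (p : M) : g.chartVolume p =
    (((volume : Measure (EuclideanSpace ℝ (Fin m))).restrict
      (extChartAt (𝓡 m) p).target).withDensity fun z ↦ ENNReal.ofReal (g.volDensity p z)).map
        (extChartAt (𝓡 m) p).symm := by
  unfold chartVolume
  simp only [coordMetric_eq]
  rfl

theorem aemeasurable_symm' (p : M) : AEMeasurable (extChartAt (𝓡 m) p).symm
    (((volume : Measure (EuclideanSpace ℝ (Fin m))).restrict
      (extChartAt (𝓡 m) p).target).withDensity fun z ↦ ENNReal.ofReal (g.volDensity p z)) :=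
  (aemeasurable_symm p).mono_ac (withDensity_absolutelyContinuous _ _)

theorem chartVolume_apply (p : M) {s : Set M} (hs : MeasurableSet s) :
    g.chartVolume p s = ∫⁻ z in (extChartAt (𝓡 m) p).target ∩ (extChartAt (𝓡 m) p).symm ⁻¹' s,
      ENNReal.ofReal (g.volDensity p z) := by
  have hT := (isOpen_target (m := m) p).measurableSet
  rw [chartVolume_eq, Measure.map_apply_of_aemeasurable (g.aemeasurable_symm' p) hs]
  have h0 : (((volume : Measure (EuclideanSpace ℝ (Fin m))).restrict
      (extChartAt (𝓡 m) p).target).withDensity fun z ↦ ENNReal.ofReal (g.volDensity p z))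
      (extChartAt (𝓡 m) p).targetᶜ = 0 :=
    withDensity_absolutelyContinuous _ _ (by
      rw [Measure.restrict_apply hT.compl, Set.compl_inter_self, measure_empty])
  rw [← measure_inter_conull' (t := (extChartAt (𝓡 m) p).target)
      (measure_mono_null (fun x hx ↦ hx.2) h0),
    Set.inter_comm, withDensity_apply _ (measurableSet_chart_preimage p hs),
    Measure.restrict_restrict (measurableSet_chart_preimage p hs)]
  congr 2
  ext z
  simp
  tauto

theorem chartVolume_inter_source (p : M) {s : Set M} (hs : MeasurableSet s) :
    g.chartVolume p (s ∩ (extChartAt (𝓡 m) p).source) = g.chartVolume p s := by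
  rw [g.chartVolume_apply p hs,
    g.chartVolume_apply p (hs.inter (isOpen_extChartAt_source p).measurableSet)]
  congr 2
  ext z
  simp only [Set.mem_inter_iff, Set.mem_preimage]
  exact ⟨fun h ↦ ⟨h.1, h.2.1⟩, fun h ↦ ⟨h.1, h.2, (extChartAt (𝓡 m) p).map_target h.1⟩⟩

/-- Change of variables along the transition map `τ`: its Jacobian is the ratio of the two densities
by `volDensity_overlap`. -/
theorem chartVolume_overlap (p q : M) {s : Set M} (hs : MeasurableSet s)
    (hsp : s ⊆ (extChartAt (𝓡 m) p).source) (hsq : s ⊆ (extChartAt (𝓡 m) q).source) :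
    g.chartVolume p s = g.chartVolume q s := by
  rw [g.chartVolume_apply p hs, g.chartVolume_apply q hs]
  set B := (extChartAt (𝓡 m) q).target ∩ (extChartAt (𝓡 m) q).symm ⁻¹' s with hB
  let τ : EuclideanSpace ℝ (Fin m) → EuclideanSpace ℝ (Fin m) :=
    fun w ↦ extChartAt (𝓡 m) p ((extChartAt (𝓡 m) q).symm w)
  have himg : (extChartAt (𝓡 m) p).target ∩ (extChartAt (𝓡 m) p).symm ⁻¹' s = τ '' B := by
    ext w
    constructor
    · rintro ⟨hw, hws⟩
      refine ⟨extChartAt (𝓡 m) q ((extChartAt (𝓡 m) p).symm w),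
        ⟨(extChartAt (𝓡 m) q).map_source (hsq hws), ?_⟩, ?_⟩
      · rw [Set.mem_preimage, (extChartAt (𝓡 m) q).left_inv (hsq hws)]
        exact hws
      · simp only [τ, (extChartAt (𝓡 m) q).left_inv (hsq hws), (extChartAt (𝓡 m) p).right_inv hw]
    · rintro ⟨z, ⟨_, hzs⟩, rfl⟩
      refine ⟨(extChartAt (𝓡 m) p).map_source (hsp hzs), ?_⟩
      rw [Set.mem_preimage, (extChartAt (𝓡 m) p).left_inv (hsp hzs)]
      exact hzs
  have hinj : Set.InjOn τ B := by
    intro z hz w hw h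
    exact (extChartAt (𝓡 m) q).symm.injOn hz.1 hw.1
      ((extChartAt (𝓡 m) p).injOn (hsp hz.2) (hsp hw.2) h)
  choose! D hD hD' using fun z (hz : z ∈ B) ↦ g.volDensity_overlap hz.1 (hsp hz.2)
  rw [himg, lintegral_image_eq_lintegral_abs_det_fderiv_mul volume
    (measurableSet_chart_preimage q hs) (fun z hz ↦ (hD z hz).hasFDerivWithinAt) hinj]
  refine setLIntegral_congr_fun (measurableSet_chart_preimage q hs) fun z hz ↦ ?_
  simp only [hD' z hz]
  rw [ENNReal.ofReal_mul (abs_nonneg _)]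

variable [SecondCountableTopology M]

/-- Second countability cuts M into countably many disjoint pieces, each inside a chart domain; ν is
the sum of the chart measures on these pieces. Agreement on overlaps makes ν restrict correctly to
every chart, including those not used in the construction. -/
theorem exists_measure_restrict_eq [Nonempty M] : ∃ ν : Measure M, (∀ p, g.chartVolume p ≤ ν) ∧
    ∀ p, ν.restrict (extChartAt (𝓡 m) p).source = g.chartVolume p := by
  obtain ⟨t, ht, htu⟩ := TopologicalSpace.countable_cover_nhds
    (fun x : M ↦ extChartAt_source_mem_nhds (I := 𝓡 m) x)
  have htne : t.Nonempty := by
    by_contra h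
    rw [Set.not_nonempty_iff_eq_empty] at h
    simp only [h, Set.mem_empty_iff_false, Set.iUnion_false, Set.iUnion_empty] at htu
    exact Set.empty_ne_univ htu
  obtain ⟨e, rfl⟩ := ht.exists_eq_range htne
  let A : ℕ → Set M := disjointed fun k ↦ (extChartAt (𝓡 m) (e k)).source
  have hsrc : ∀ p : M, MeasurableSet (extChartAt (𝓡 m) p).source := fun p ↦
    (isOpen_extChartAt_source p).measurableSet
  have hA : ∀ k, MeasurableSet (A k) := fun k ↦ MeasurableSet.disjointed (fun i ↦ hsrc (e i)) k
  have hAd : Pairwise (Function.onFun Disjoint A) := disjoint_disjointed _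
  have hAu : ⋃ k, A k = Set.univ := by
    rw [iUnion_disjointed, ← htu, Set.biUnion_range]
  have hAs : ∀ k, A k ⊆ (extChartAt (𝓡 m) (e k)).source := fun k ↦ disjointed_subset _ k
  let ν : Measure M := Measure.sum fun k ↦ (g.chartVolume (e k)).restrict (A k)
  have key : ∀ p, ν.restrict (extChartAt (𝓡 m) p).source = g.chartVolume p := by
    intro p
    have h1 : g.chartVolume p = Measure.sum fun k ↦ (g.chartVolume p).restrict (A k) := by
      rw [← Measure.restrict_iUnion hAd hA, hAu, Measure.restrict_univ]
    rw [h1]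
    ext s hs
    rw [Measure.restrict_apply hs, Measure.sum_apply _ (hs.inter (hsrc p)),
      Measure.sum_apply _ hs]
    refine tsum_congr fun k ↦ ?_
    rw [Measure.restrict_apply (hs.inter (hsrc p)), Measure.restrict_apply hs,
      ← g.chartVolume_inter_source p (hs.inter (hA k)), Set.inter_right_comm]
    exact g.chartVolume_overlap _ _ ((hs.inter (hA k)).inter (hsrc p))
      (fun x hx ↦ hAs k hx.1.2) fun x hx ↦ hx.2
  exact ⟨ν, fun p ↦ (key p).symm.le.trans Measure.restrict_le_self, key⟩

/-- In the domain of a chart, the volume measure is given by the metric density. -/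
theorem volumeMeasure_restrict (p : M) :
    g.volumeMeasure.restrict (extChartAt (𝓡 m) p).source = g.chartVolume p := by
  have : Nonempty M := ⟨p⟩
  obtain ⟨ν, h1, h2⟩ := g.exists_measure_restrict_eq
  -- The supremum lies below the upper bound ν, which gives one inequality. For the other, it
  -- dominates each chart measure, and a chart measure equals its restriction to the chart domain.
  have hs : g.volumeMeasure ≤ ν := iSup_le h1
  refine le_antisymm ((Measure.restrict_mono le_rfl hs).trans (h2 p).le) ?_
  have h3 : g.chartVolume p ≤ g.volumeMeasure := le_iSup g.chartVolume p
  calc g.chartVolume p = ν.restrict (extChartAt (𝓡 m) p).source := (h2 p).symm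
    _ = (ν.restrict (extChartAt (𝓡 m) p).source).restrict (extChartAt (𝓡 m) p).source := by
      rw [Measure.restrict_restrict (isOpen_extChartAt_source p).measurableSet, Set.inter_self]
    _ = (g.chartVolume p).restrict (extChartAt (𝓡 m) p).source := by rw [h2]
    _ ≤ _ := Measure.restrict_mono le_rfl h3

/-- Near `p` the measure is bounded by the integral of a continuous density over a compact set of
coordinates. -/
theorem isLocallyFiniteMeasure_volumeMeasure : IsLocallyFiniteMeasure g.volumeMeasure := by
  refine ⟨fun p ↦ ?_⟩
  have hz := mem_extChartAt_target (I := 𝓡 m) p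
  obtain ⟨K, hK, hzK, hKT⟩ := exists_compact_subset (isOpen_target p) hz
  set N := (extChartAt (𝓡 m) p).source ∩ extChartAt (𝓡 m) p ⁻¹' interior K
  have hN : IsOpen N := (continuousOn_extChartAt p).isOpen_inter_preimage
    (isOpen_extChartAt_source p) isOpen_interior
  refine ⟨N, hN.mem_nhds ⟨mem_extChartAt_source p, hzK⟩, ?_⟩
  have h1 : g.volumeMeasure N = g.chartVolume p N := by
    rw [← g.volumeMeasure_restrict p, Measure.restrict_apply hN.measurableSet]
    congr 1
    exact (Set.inter_eq_left.2 fun x hx ↦ hx.1).symm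
  rw [h1, g.chartVolume_apply p hN.measurableSet]
  have hint : IntegrableOn (g.volDensity p) K :=
    ((g.continuousOn_volDensity p).mono hKT).integrableOn_compact hK
  refine lt_of_le_of_lt (lintegral_mono_set (t := K) ?_) hint.lintegral_lt_top
  rintro z ⟨hz, hzs, hzK⟩
  rw [Set.mem_preimage, (extChartAt (𝓡 m) p).right_inv hz] at hzK
  exact interior_subset hzK

theorem integral_volumeMeasure (p : M) {f : M → ℝ} (hf : Continuous f)
    (hfs : ∀ x ∉ (extChartAt (𝓡 m) p).source, f x = 0) :
    ∫ x, f x ∂g.volumeMeasure = ∫ z in (extChartAt (𝓡 m) p).target,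
      g.volDensity p z * f ((extChartAt (𝓡 m) p).symm z) := by
  rw [← setIntegral_eq_integral_of_forall_compl_eq_zero hfs, g.volumeMeasure_restrict,
    chartVolume_eq, integral_map (g.aemeasurable_symm' p) hf.aestronglyMeasurable,
    integral_withDensity_eq_integral_toReal_smul₀]
  · simp only [ENNReal.toReal_ofReal (g.volDensity_nonneg p _), smul_eq_mul]
  · exact ((g.continuousOn_volDensity p).aemeasurable (isOpen_target p).measurableSet).ennreal_ofReal
  · simp

end SemiRiemannianMetric

end Volume

end Paracontact
end

noncomputable section

namespace Paracontact

/-! ### The divergence theorem for compactly supported fields on an open set. -/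

section Divergence

variable {E : Type*} [NormedAddCommGroup E] [NormedSpace ℝ E]

/-- Points outside U lie in the open complement of K, where the extension by zero vanishes
identically. -/
theorem contDiff_indicator {f : E → ℝ} {U K : Set E} (hU : IsOpen U) (hK : IsClosed K)
    (hKU : K ⊆ U) (hf : ContDiffOn ℝ ∞ f U) (h0 : ∀ z ∈ U, z ∉ K → f z = 0) :
    ContDiff ℝ ∞ (U.indicator f) := by
  refine contDiff_iff_contDiffAt.2 fun z ↦ ?_
  by_cases hz : z ∈ U
  · refine (contDiffAt_of_mem hU hf hz).congr_of_eventuallyEq ?_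
    filter_upwards [hU.mem_nhds hz] with w hw using Set.indicator_of_mem hw _
  · refine (contDiffAt_const (c := (0 : ℝ))).congr_of_eventuallyEq ?_
    filter_upwards [hK.isOpen_compl.mem_nhds fun h ↦ hz (hKU h)] with w hw
    by_cases hwU : w ∈ U
    · rw [Set.indicator_of_mem hwU, h0 w hwU hw]
    · exact Set.indicator_of_notMem hwU _

theorem hasCompactSupport_indicator {E : Type*} [TopologicalSpace E] [R1Space E] {f : E → ℝ} {U K : Set E} (hK : IsCompact K)
    (h0 : ∀ z ∈ U, z ∉ K → f z = 0) : HasCompactSupport (U.indicator f) := by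
  refine HasCompactSupport.intro hK fun z hz ↦ ?_
  by_cases hzU : z ∈ U
  · rw [Set.indicator_of_mem hzU, h0 z hzU hz]
  · exact Set.indicator_of_notMem hzU _

theorem fderiv_indicator_of_mem {f : E → ℝ} {U : Set E} (hU : IsOpen U) {z : E} (hz : z ∈ U) :
    fderiv ℝ (U.indicator f) z = fderiv ℝ f z :=
  fderiv_eq_of_eqOn hU (fun _ hw ↦ Set.indicator_of_mem hw _) hz

theorem fderiv_indicator_of_notMem {f : E → ℝ} {U K : Set E} (hK : IsClosed K) (hKU : K ⊆ U)
    (h0 : ∀ z ∈ U, z ∉ K → f z = 0) {z : E} (hz : z ∉ U) :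
    fderiv ℝ (U.indicator f) z = 0 := by
  have : U.indicator f =ᶠ[𝓝 z] fun _ ↦ (0 : ℝ) := by
    filter_upwards [hK.isOpen_compl.mem_nhds fun h ↦ hz (hKU h)] with w hw
    by_cases hwU : w ∈ U
    · rw [Set.indicator_of_mem hwU, h0 w hwU hw]
    · exact Set.indicator_of_notMem hwU _
  rw [this.fderiv_eq, fderiv_fun_const]
  rfl

variable [MeasurableSpace E] [BorelSpace E] (μ : Measure E)
  [μ.IsAddHaarMeasure]

theorem integrable_fderiv_apply {f : E → ℝ} (hf : ContDiff ℝ ∞ f) (hfc : HasCompactSupport f)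
    (v : E) : Integrable (fun z ↦ fderiv ℝ f z v) μ :=
  ((hf.continuous_fderiv (by simp)).clm_apply continuous_const).integrable_of_hasCompactSupport
    (hfc.fderiv_apply ℝ v)

/-- Integration by parts against the constant function 1. -/
theorem integral_fderiv_apply_eq_zero [FiniteDimensional ℝ E] {f : E → ℝ} (hf : ContDiff ℝ ∞ f)
    (hfc : HasCompactSupport f) (v : E) : ∫ z, fderiv ℝ f z v ∂μ = 0 := by
  have h := integral_mul_fderiv_eq_neg_fderiv_mul_of_integrable (μ := μ) (f := fun _ : E ↦ (1 : ℝ))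
    (g := f) (v := v) (by simp) (by simpa using integrable_fderiv_apply μ hf hfc v)
    (by simpa using hf.continuous.integrable_of_hasCompactSupport hfc)
    (fun _ _ ↦ differentiableAt_const _) (fun x _ ↦ hf.differentiable (by simp) x)
  simpa using h

theorem setIntegral_sum_fderiv_eq_zero [FiniteDimensional ℝ E] {ι : Type*} [Fintype ι] {f : ι → E → ℝ} {U K : Set E}
    (hU : IsOpen U) (hK : IsCompact K) (hKU : K ⊆ U) (hf : ∀ i, ContDiffOn ℝ ∞ (f i) U)
    (h0 : ∀ i, ∀ z ∈ U, z ∉ K → f i z = 0) (v : ι → E) :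
    ∫ z in U, ∑ i, fderiv ℝ (f i) z (v i) ∂μ = 0 := by
  have hf' := fun i ↦ contDiff_indicator hU hK.isClosed hKU (hf i) (h0 i)
  have hfc := fun i ↦ hasCompactSupport_indicator hK (h0 i)
  rw [setIntegral_congr_fun (g := fun z ↦ ∑ i, fderiv ℝ (U.indicator (f i)) z (v i))
    hU.measurableSet fun z hz ↦ by simp only [fderiv_indicator_of_mem hU hz],
    setIntegral_eq_integral_of_forall_compl_eq_zero fun z hz ↦ by
      simp only [fderiv_indicator_of_notMem hK.isClosed hKU (h0 _) hz, zero_apply,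
        Finset.sum_const_zero],
    integral_finsetSum _ fun i _ ↦ integrable_fderiv_apply μ (hf' i) (hfc i) _]
  exact Finset.sum_eq_zero fun i _ ↦ integral_fderiv_apply_eq_zero μ (hf' i) (hfc i) _

end Divergence

/-! ### The polarized energy density tr g(∇V, ∇Y). -/

section Pairing

set_option maxSynthPendingDepth 3

variable {m : ℕ} {M : Type*} [TopologicalSpace M] [ChartedSpace (EuclideanSpace ℝ (Fin m)) M]

theorem exists_eq_symm (x : M) : ∃ p : M, ∃ z ∈ (extChartAt (𝓡 m) p).target,
    (extChartAt (𝓡 m) p).symm z = x :=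
  ⟨x, extChartAt (𝓡 m) x x, mem_extChartAt_target x,
    (extChartAt (𝓡 m) x).left_inv (mem_extChartAt_source x)⟩

theorem covD_zero {E : Type*} [NormedAddCommGroup E] [NormedSpace ℝ E]
    (G : E → E →L[ℝ] E →L[ℝ] ℝ) (z : E) : covD G (fun _ ↦ 0) z = 0 := by
  ext v
  simp

theorem covD_sum {E ι : Type*} [NormedAddCommGroup E] [NormedSpace ℝ E]
    (G : E → E →L[ℝ] E →L[ℝ] ℝ) {s : Finset ι} {Y : ι → E → E} {z : E}
    (hY : ∀ i ∈ s, DifferentiableAt ℝ (Y i) z) :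
    covD G (fun y ↦ ∑ i ∈ s, Y i y) z = ∑ i ∈ s, covD G (Y i) z := by
  ext v
  simp only [covD_apply, fderiv_fun_sum hY, sum_apply, map_sum, Finset.sum_add_distrib]

variable [IsManifold (𝓡 m) ∞ M]

namespace SemiRiemannianMetric

variable (g : SemiRiemannianMetric m M)

/-- The bases in the definition need not vary continuously with the point, so continuity is checked
on the coordinate expression. -/
theorem continuous_energyPairing {V Y : VField m M} (hV : SmoothVField V) (hY : SmoothVField Y) :
    Continuous (g.energyPairing V Y) := by
  refine continuous_iff_continuousAt.2 fun x ↦ ?_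
  have hG := g.isLocalMetric x
  have hsrc := (isOpen_extChartAt_source (I := 𝓡 m) x).mem_nhds (mem_extChartAt_source x)
  have h : ContinuousOn (fun z ↦ ∑ i, g.coord x z (covD (g.coord x) (coordField x V) z (stdBasis m i))
      (covD (g.coord x) (coordField x Y) z (dualFrame (g.coord x) (stdBasis m) z i)))
      (extChartAt (𝓡 m) x).target := by
    refine continuousOn_finsetSum _ fun i _ ↦ ?_
    exact (hG.contDiffOn.continuousOn.clm_apply
      ((hG.contDiffOn_covD (hV.contDiffOn x)).continuousOn.clm_apply continuousOn_const)).clm_apply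
      ((hG.contDiffOn_covD (hY.contDiffOn x)).continuousOn.clm_apply
        (hG.contDiffOn_dualFrame (stdBasis m) i).continuousOn)
  have h2 := (h.continuousAt ((isOpen_target x).mem_nhds (mem_extChartAt_target x))).comp
    (continuousAt_extChartAt (I := 𝓡 m) x)
  refine h2.congr ?_
  filter_upwards [hsrc] with y hy
  have := g.energyPairing_eq ((extChartAt (𝓡 m) x).map_source hy) (hV.smoothVFieldAt _)
    (hY.smoothVFieldAt _)
  rw [(extChartAt (𝓡 m) x).left_inv hy] at this
  exact this.symm

theorem energyPairing_eq_zero {V Y : VField m M} (hV : SmoothVField V) (hY : SmoothVField Y)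
    {x : M} (h : ∀ᶠ y in 𝓝 x, Y y = 0) : g.energyPairing V Y x = 0 := by
  obtain ⟨p, z, hz, rfl⟩ := exists_eq_symm (m := m) x
  have : coordField p Y =ᶠ[𝓝 z] fun _ ↦ 0 := by
    filter_upwards [(symm_continuousAt hz).eventually h] with w hw
    rw [coordField, hw, map_zero]
  rw [g.energyPairing_eq hz (hV.smoothVFieldAt _) (hY.smoothVFieldAt _), covD_congr this, covD_zero]
  simp only [zero_apply, map_zero, Finset.sum_const_zero]

theorem energyPairing_eq_zero_of_notMem [T2Space M] {V Y : VField m M} (hV : SmoothVField V)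
    (hY : SmoothVField Y) {K : Set M} (hK : IsCompact K) (hYK : ∀ x ∉ K, Y x = 0) {x : M}
    (hx : x ∉ K) : g.energyPairing V Y x = 0 :=
  g.energyPairing_eq_zero hV hY (Filter.eventually_of_mem (hK.isClosed.isOpen_compl.mem_nhds hx) hYK)

theorem energyPairing_sum {ι : Type*} {s : Finset ι} {V : VField m M} {Y : ι → VField m M}
    (hV : SmoothVField V) (hY : ∀ i, SmoothVField (Y i))
    (hs : SmoothVField (fun x ↦ ∑ i ∈ s, Y i x)) (x : M) :
    g.energyPairing V (fun x ↦ ∑ i ∈ s, Y i x) x = ∑ i ∈ s, g.energyPairing V (Y i) x := by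
  obtain ⟨p, z, hz, rfl⟩ := exists_eq_symm (m := m) x
  have e : coordField p (fun x ↦ ∑ i ∈ s, Y i x) = fun z ↦ ∑ i ∈ s, coordField p (Y i) z :=
    funext fun z ↦ map_sum _ _ _
  simp only [fun i ↦ g.energyPairing_eq hz (hV.smoothVFieldAt _) ((hY i).smoothVFieldAt _)]
  rw [g.energyPairing_eq hz (hV.smoothVFieldAt _) (hs.smoothVFieldAt _), e,
    covD_sum _ fun i _ ↦ ((hY i).smoothVFieldAt _).differentiableAt hz, Finset.sum_comm]
  simp only [sum_apply, map_sum]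

end SemiRiemannianMetric

end Pairing

/-! ### Vanishing of ∫ tr g(∇ξ, ∇Y) for Y ⊥ ξ of compact support. -/

section Integral

set_option maxSynthPendingDepth 3

variable {n : ℕ} {M : Type*} [TopologicalSpace M] [T2Space M]
  [ChartedSpace (EuclideanSpace ℝ (Fin (2 * n + 1))) M] [IsManifold (𝓡 (2 * n + 1)) ∞ M]
  [MeasurableSpace M] [BorelSpace M] [SecondCountableTopology M]
  {S : ParacontactMetricStructure n M}

namespace ParacontactMetricStructure

/-- In a single chart, `density_mul_sum_eq` makes the integrand times the density the coordinate
divergence of a field supported in the image of K. -/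
theorem IsEtaEinstein.integral_energyPairing_eq_zero_of_subset (hS : S.IsEtaEinstein)
    {Y : VField (2 * n + 1) M} (hY : SmoothVField Y) (hYξ : ∀ x, S.g.val x (Y x) (S.ξ x) = 0)
    {p : M} {K : Set M} (hK : IsCompact K) (hKp : K ⊆ (extChartAt (𝓡 (2 * n + 1)) p).source)
    (hYK : ∀ x ∉ K, Y x = 0) : ∫ x, S.g.energyPairing S.ξ Y x ∂S.g.volumeMeasure = 0 := by
  have hP := S.isLocalParacontact p
  have hG := S.g.isLocalMetric p
  rw [S.g.integral_volumeMeasure p (S.g.continuous_energyPairing S.smooth_ξ hY) fun x hx ↦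
    S.g.energyPairing_eq_zero_of_notMem S.smooth_ξ hY hK hYK fun h ↦ hx (hKp h)]
  have hYc := hY.contDiffOn p
  have hX : ContDiffOn ℝ ∞ (fun y ↦ sharp (S.g.coord p) y (S.g.coord p y (coordField p Y y) ∘L
      covD (S.g.coord p) (coordField p S.ξ) y)) (extChartAt (𝓡 (2 * n + 1)) p).target :=
    hG.contDiffOn_sharp.clm_apply ((hG.contDiffOn.clm_apply hYc).clm_comp
      (hG.contDiffOn_covD hP.contDiffOn_ξ))
  have hK' : IsCompact (extChartAt (𝓡 (2 * n + 1)) p '' K) :=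
    hK.image_of_continuousOn ((continuousOn_extChartAt p).mono hKp)
  have hK'T : extChartAt (𝓡 (2 * n + 1)) p '' K ⊆ (extChartAt (𝓡 (2 * n + 1)) p).target := by
    rintro _ ⟨x, hx, rfl⟩
    exact (extChartAt (𝓡 (2 * n + 1)) p).map_source (hKp hx)
  rw [← setIntegral_sum_fderiv_eq_zero volume (isOpen_target p) hK' hK'T
    (f := fun j y ↦ density (S.g.coord p) (stdBasis (2 * n + 1)) y *
      coordL (stdBasis (2 * n + 1)) j (sharp (S.g.coord p) y
        (S.g.coord p y (coordField p Y y) ∘L covD (S.g.coord p) (coordField p S.ξ) y)))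
    (fun j ↦ (hG.contDiffOn_density _).mul ((coordL _ j).contDiff.comp_contDiffOn hX))
    (fun j z hz hzK ↦ ?_) (stdBasis (2 * n + 1))]
  · refine setIntegral_congr_fun (isOpen_target p).measurableSet fun z hz ↦ ?_
    have h0 : S.g.coord p z (coordField p Y z) (coordField p S.ξ z) = 0 := by
      rw [coordField, coordField, S.g.coord_coframe hz, hYξ]
    have h1 := hS.coordRicci_eq_zero S hz h0
    have h2 := hP.density_mul_sum_eq (stdBasis (2 * n + 1)) hYc hz h0 h1
    rw [← h2, S.g.energyPairing_eq hz (S.smooth_ξ.smoothVFieldAt _) (hY.smoothVFieldAt _)]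
    rfl
  · have : coordField p Y z = 0 := by
      rw [coordField, hYK _ fun h ↦ hzK ⟨_, h, (extChartAt (𝓡 (2 * n + 1)) p).right_inv hz⟩,
        map_zero]
    simp [this]

/-- Y is split by a partition of unity subordinate to the chart domains. The pieces f_i Y stay
orthogonal to ξ, each vanishes off a compact subset of one chart domain, and compactness of K leaves
only finitely many of them. -/
theorem IsEtaEinstein.integral_energyPairing_eq_zero (hS : S.IsEtaEinstein)
    {Y : VField (2 * n + 1) M} (hY : SmoothVField Y) (hYξ : ∀ x, S.g.val x (Y x) (S.ξ x) = 0)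
    {K : Set M} (hK : IsCompact K) (hYK : ∀ x ∉ K, Y x = 0) :
    ∫ x, S.g.energyPairing S.ξ Y x ∂S.g.volumeMeasure = 0 := by
  have : LocallyCompactSpace M := ChartedSpace.locallyCompactSpace
    (EuclideanSpace ℝ (Fin (2 * n + 1))) M
  have := S.g.isLocallyFiniteMeasure_volumeMeasure
  obtain ⟨f, hf⟩ := SmoothPartitionOfUnity.exists_isSubordinate_chartAt_source
    (𝓡 (2 * n + 1)) M
  have hfin := f.locallyFinite.finite_nonempty_inter_compact hK
  have hYi : ∀ i, SmoothVField (fun x ↦ f i x • Y x) := fun i ↦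
    ContMDiff.smul_section (f i).contMDiff hY
  have hsum : Y = fun x ↦ ∑ i ∈ hfin.toFinset, f i x • Y x := by
    funext x
    by_cases hx : x ∈ K
    · rw [← Finset.sum_smul]
      have h1 := f.sum_eq_one (Set.mem_univ x)
      rw [finsum_eq_sum_of_support_subset (s := hfin.toFinset)] at h1
      · rw [h1, one_smul]
      · intro i hi
        simp only [Set.Finite.coe_toFinset]
        exact ⟨x, hi, hx⟩
    · simp [hYK x hx]
  have hYs : SmoothVField (fun x ↦ ∑ i ∈ hfin.toFinset, f i x • Y x) := hsum ▸ hY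
  have hKi : ∀ i, IsCompact (tsupport (f i) ∩ K) := fun i ↦ hK.inter_left (isClosed_tsupport _)
  have hY0 : ∀ i, ∀ x ∉ tsupport (f i) ∩ K, f i x • Y x = 0 := fun i x hx ↦ by
    by_cases hxK : x ∈ K
    · rw [image_eq_zero_of_notMem_tsupport fun h ↦ hx ⟨h, hxK⟩, zero_smul]
    · rw [hYK x hxK, smul_zero]
  have e : S.g.energyPairing S.ξ Y = fun x ↦ ∑ i ∈ hfin.toFinset,
      S.g.energyPairing S.ξ (fun x ↦ f i x • Y x) x := by
    funext x
    rw [← S.g.energyPairing_sum S.smooth_ξ hYi hYs, ← hsum]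
  rw [e, integral_finsetSum]
  · refine Finset.sum_eq_zero fun i _ ↦ hS.integral_energyPairing_eq_zero_of_subset (hYi i)
      (fun x ↦ ?_) (p := i) (hKi i) (fun x hx ↦ ?_) (hY0 i)
    · rw [map_smul, smul_apply, hYξ, smul_zero]
    · rw [extChartAt_source]
      exact hf i hx.1
  · intro i _
    refine (S.g.continuous_energyPairing S.smooth_ξ (hYi i)).integrable_of_hasCompactSupport ?_
    exact HasCompactSupport.intro (hKi i) fun x hx ↦
      S.g.energyPairing_eq_zero_of_notMem S.smooth_ξ (hYi i) (hKi i) (hY0 i) hx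

end ParacontactMetricStructure

end Integral

end Paracontact
end

noncomputable section

namespace Paracontact

/-! ### Time-dependent vector fields in coordinates. -/

section LocalVariation

set_option maxSynthPendingDepth 3

variable {E : Type*} [NormedAddCommGroup E] [NormedSpace ℝ E]

theorem hasDerivAt_prodMk_left {F' : Type*} [NormedAddCommGroup F'] [NormedSpace ℝ F']
    {f : ℝ × E → F'} {t : ℝ} {z : E} (hf : DifferentiableAt ℝ f (t, z)) :
    HasDerivAt (fun s ↦ f (s, z)) (fderiv ℝ f (t, z) (1, 0)) t := by
  have h : HasDerivAt (fun s : ℝ ↦ (s, z)) ((1 : ℝ), (0 : E)) t :=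
    (hasDerivAt_id t).prodMk (hasDerivAt_const t z)
  exact hf.hasFDerivAt.comp_hasDerivAt (f := fun s ↦ (s, z)) t h

theorem hasFDerivAt_prodMk_right' {F' : Type*} [NormedAddCommGroup F'] [NormedSpace ℝ F']
    {f : ℝ × E → F'} {t : ℝ} {z : E} (hf : DifferentiableAt ℝ f (t, z)) :
    HasFDerivAt (fun y ↦ f (t, y)) (fderiv ℝ f (t, z) ∘L ContinuousLinearMap.inr ℝ ℝ E) z :=
  hf.hasFDerivAt.comp (f := fun y ↦ (t, y)) z (hasFDerivAt_prodMk_right t z)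

/-- The covariant derivative in the direction of `E` of a time-dependent vector field on `E`. -/
def timeCovD (G : E → E →L[ℝ] E →L[ℝ] ℝ) (F : ℝ × E → E) (w : ℝ × E) : E →L[ℝ] E :=
  fderiv ℝ F w ∘L ContinuousLinearMap.inr ℝ ℝ E + (christoffel G w.2).flip (F w)

variable {G : E → E →L[ℝ] E →L[ℝ] ℝ} {F : ℝ × E → E} {J : Set ℝ} {U : Set E}

theorem covD_eq_timeCovD {t : ℝ} {z : E} (hF : DifferentiableAt ℝ F (t, z)) :
    covD G (fun y ↦ F (t, y)) z = timeCovD G F (t, z) := by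
  rw [covD, (hasFDerivAt_prodMk_right' hF).fderiv, timeCovD]

theorem IsLocalMetric.contDiffOn_timeCovD [FiniteDimensional ℝ E] (hG : IsLocalMetric U G) (hJ : IsOpen J)
    (hF : ContDiffOn ℝ ∞ F (J ×ˢ U)) : ContDiffOn ℝ ∞ (timeCovD G F) (J ×ˢ U) := by
  have h1 : ContDiffOn ℝ ∞ (fderiv ℝ F) (J ×ˢ U) :=
    hF.fderiv_of_isOpen (hJ.prod hG.isOpen) (by simp)
  have h2 : ContDiffOn ℝ ∞ (fun w : ℝ × E ↦ christoffel G w.2) (J ×ˢ U) :=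
    hG.contDiffOn_christoffel.comp contDiffOn_snd fun w hw ↦ hw.2
  have h3 : ContDiffOn ℝ ∞ (fun w : ℝ × E ↦ (christoffel G w.2).flip) (J ×ˢ U) :=
    (ContinuousLinearMap.flipₗᵢ ℝ E E E).toContinuousLinearEquiv.contDiff.comp_contDiffOn h2
  exact (h1.clm_comp contDiffOn_const).add (h3.clm_apply hF)

/-- ∂_t commutes with ∇: mixed partial derivatives of F agree, and Γ does not depend on time. -/
theorem IsLocalMetric.hasDerivAt_timeCovD (hG : IsLocalMetric U G) (hJ : IsOpen J)
    (hF : ContDiffOn ℝ ∞ F (J ×ˢ U)) {t : ℝ} (ht : t ∈ J) {z : E} (hz : z ∈ U) :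
    HasDerivAt (fun s ↦ timeCovD G F (s, z))
      (covD G (fun y ↦ fderiv ℝ F (t, y) (1, 0)) z) t := by
  have hO := hJ.prod hG.isOpen
  have hF1 : ContDiffOn ℝ ∞ (fderiv ℝ F) (J ×ˢ U) := hF.fderiv_of_isOpen hO (by simp)
  have hw : (t, z) ∈ J ×ˢ U := ⟨ht, hz⟩
  have hd := hasDerivAt_prodMk_left (differentiableAt_of_mem hO hF hw)
  have hd1 := hasDerivAt_prodMk_left (differentiableAt_of_mem hO hF1 hw)
  have hs : IsSymmSndFDerivAt ℝ F (t, z) :=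
    (contDiffAt_of_mem hO hF hw).isSymmSndFDerivAt (by simpa using ENat.LEInfty.out)
  have ha : HasDerivAt (fun s ↦ fderiv ℝ F (s, z) ∘L ContinuousLinearMap.inr ℝ ℝ E)
      (fderiv ℝ (fderiv ℝ F) (t, z) (1, 0) ∘L ContinuousLinearMap.inr ℝ ℝ E) t :=
    HasFDerivAt.comp_hasDerivAt (f := fun s ↦ fderiv ℝ F (s, z)) t
      (ContinuousLinearMap.precomp E (ContinuousLinearMap.inr ℝ ℝ E)).hasFDerivAt hd1
  have hb : HasDerivAt (fun s ↦ (christoffel G z).flip (F (s, z)))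
      ((christoffel G z).flip (fderiv ℝ F (t, z) (1, 0))) t :=
    (christoffel G z).flip.hasFDerivAt.comp_hasDerivAt t hd
  have hc : HasDerivAt (fun s ↦ timeCovD G F (s, z))
      (fderiv ℝ (fderiv ℝ F) (t, z) (1, 0) ∘L ContinuousLinearMap.inr ℝ ℝ E +
        (christoffel G z).flip (fderiv ℝ F (t, z) (1, 0))) t :=
    ha.add hb
  convert hc using 1
  ext v
  have h2 := hasFDerivAt_prodMk_right' (f := fun w ↦ fderiv ℝ F w (1, 0)) (t := t) (z := z)
    ((differentiableAt_of_mem hO hF1 hw).clm_apply (differentiableAt_const _))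
  rw [covD_apply, h2.fderiv, ContinuousLinearMap.comp_apply,
    fderiv_clm_apply (differentiableAt_of_mem hO hF1 hw) (differentiableAt_const _)]
  simp [hs.eq (0, v) (1, 0)]

/-- The square length of the covariant derivative of a time-dependent vector field. -/
def timeEnergy [FiniteDimensional ℝ E] {ι : Type*} [Fintype ι] (G : E → E →L[ℝ] E →L[ℝ] ℝ) (b : Module.Basis ι ℝ E)
    (F : ℝ × E → E) (w : ℝ × E) : ℝ :=
  ∑ i, G w.2 (timeCovD G F w (b i)) (timeCovD G F w (dualFrame G b w.2 i))

variable [FiniteDimensional ℝ E] {ι : Type*} [Fintype ι] (b : Module.Basis ι ℝ E)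

theorem IsLocalMetric.contDiffOn_timeEnergy (hG : IsLocalMetric U G) (hJ : IsOpen J)
    (hF : ContDiffOn ℝ ∞ F (J ×ˢ U)) : ContDiffOn ℝ ∞ (timeEnergy G b F) (J ×ˢ U) := by
  have hA := hG.contDiffOn_timeCovD hJ hF
  have h1 : ContDiffOn ℝ ∞ (fun w : ℝ × E ↦ G w.2) (J ×ˢ U) :=
    hG.contDiffOn.comp contDiffOn_snd fun w hw ↦ hw.2
  have h2 : ∀ i, ContDiffOn ℝ ∞ (fun w : ℝ × E ↦ dualFrame G b w.2 i) (J ×ˢ U) := fun i ↦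
    (hG.contDiffOn_dualFrame b i).comp contDiffOn_snd fun w hw ↦ hw.2
  exact ContDiffOn.sum fun i _ ↦ (h1.clm_apply (hA.clm_apply contDiffOn_const)).clm_apply
    (hA.clm_apply (h2 i))

theorem IsLocalMetric.hasDerivAt_timeEnergy (hG : IsLocalMetric U G) (hJ : IsOpen J)
    (hF : ContDiffOn ℝ ∞ F (J ×ˢ U)) {t : ℝ} (ht : t ∈ J) {z : E} (hz : z ∈ U) :
    HasDerivAt (fun s ↦ timeEnergy G b F (s, z))
      (2 * ∑ i, G z (covD G (fun y ↦ F (t, y)) z (b i))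
        (covD G (fun y ↦ fderiv ℝ F (t, y) (1, 0)) z (dualFrame G b z i))) t := by
  have hw : (t, z) ∈ J ×ˢ U := ⟨ht, hz⟩
  have hA := hG.hasDerivAt_timeCovD hJ hF ht hz
  set B := covD G (fun y ↦ fderiv ℝ F (t, y) (1, 0)) z
  rw [covD_eq_timeCovD (differentiableAt_of_mem (hJ.prod hG.isOpen) hF hw)]
  have h : HasDerivAt (fun s ↦ timeEnergy G b F (s, z))
      (∑ i, (G z (B (b i)) (timeCovD G F (t, z) (dualFrame G b z i)) +
        G z (timeCovD G F (t, z) (b i)) (B (dualFrame G b z i)))) t := by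
    refine HasDerivAt.fun_sum fun i _ ↦ ?_
    have h1 := hA.clm_apply (hasDerivAt_const t (b i))
    have h2 := hA.clm_apply (hasDerivAt_const t (dualFrame G b z i))
    have h3 := ((G z).hasFDerivAt.comp_hasDerivAt t h1).clm_apply h2
    simpa using h3
  convert h using 1
  have hf : IsBilin fun u v ↦ G z (timeCovD G F (t, z) u) (B v) :=
    isBilin_clm ((G z).bilinearComp (timeCovD G F (t, z)) B)
  -- The two terms of the product rule have equal traces, which gives the factor 2.
  have e := (hG.isDualPair b hz).trace_swap (hG.symm z hz) hf
  simp only [hG.symm z hz (B _)]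
  rw [Finset.sum_add_distrib, e, two_mul]

end LocalVariation

/-! ### The variation field and the first variation of the energy. -/

section Variation

set_option maxSynthPendingDepth 3

variable {m : ℕ} {M : Type*} [TopologicalSpace M] [ChartedSpace (EuclideanSpace ℝ (Fin m)) M]

/-- The variation field of a family of vector fields. -/
def variationField (W : ℝ → VField m M) : VField m M :=
  fun x ↦ deriv (fun t ↦ (W t x : EuclideanSpace ℝ (Fin m))) 0

/-- A family of vector fields in the chart at `p`. -/
def coordFamily (p : M) (W : ℝ → VField m M) (w : ℝ × EuclideanSpace ℝ (Fin m)) :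
    EuclideanSpace ℝ (Fin m) :=
  coordField p (W w.1) w.2

variable [IsManifold (𝓡 m) ∞ M] {g : SemiRiemannianMetric m M} {r : ℝ} {V : VField m M}
  {D : Set M} {ε : ℝ} {W : ℝ → VField m M}

namespace SemiRiemannianMetric.IsVariation

theorem zero_mem (h : g.IsVariation r V D ε W) : (0 : ℝ) ∈ Set.Ioo (-ε) ε :=
  ⟨neg_lt_zero.2 h.pos, h.pos⟩

theorem contDiffOn_coordFamily (h : g.IsVariation r V D ε W) (p : M) :
    ContDiffOn ℝ ∞ (coordFamily p W) (Set.Ioo (-ε) ε ×ˢ (extChartAt (𝓡 m) p).target) := by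
  rw [← contMDiffOn_iff_contDiffOn]
  have h1 : ContMDiffOn 𝓘(ℝ, ℝ × EuclideanSpace ℝ (Fin m)) 𝓘(ℝ, EuclideanSpace ℝ (Fin m)) ∞
      (fun w : ℝ × EuclideanSpace ℝ (Fin m) ↦ w.2)
      (Set.Ioo (-ε) ε ×ˢ (extChartAt (𝓡 m) p).target) := contDiff_snd.contMDiff.contMDiffOn
  have h2 : ContMDiffOn 𝓘(ℝ, ℝ × EuclideanSpace ℝ (Fin m)) 𝓘(ℝ, ℝ) ∞
      (fun w : ℝ × EuclideanSpace ℝ (Fin m) ↦ w.1)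
      (Set.Ioo (-ε) ε ×ˢ (extChartAt (𝓡 m) p).target) := contDiff_fst.contMDiff.contMDiffOn
  have h3 := h2.prodMk ((contMDiffOn_symm p).comp h1 fun w hw ↦ hw.2)
  exact (contMDiffOn_tangent_iff (b := fun w : ℝ × EuclideanSpace ℝ (Fin m) ↦ w.2)
    (v := fun w ↦ W w.1 ((extChartAt (𝓡 m) p).symm w.2)) h1 fun w hw ↦ hw.2).1
    (h.smooth.comp h3 fun w hw ↦ ⟨hw.1, trivial⟩)

theorem energyDensity_eq (h : g.IsVariation r V D ε W) {p : M} {t : ℝ} (ht : t ∈ Set.Ioo (-ε) ε)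
    {z : EuclideanSpace ℝ (Fin m)} (hz : z ∈ (extChartAt (𝓡 m) p).target) :
    g.energyDensity (W t) ((extChartAt (𝓡 m) p).symm z) =
      1 / 2 * (m + timeEnergy (g.coord p) (stdBasis m) (coordFamily p W) (t, z)) := by
  have hW := (h.mem t ht).1.smoothVFieldAt ((extChartAt (𝓡 m) p).symm z)
  have hF := differentiableAt_of_mem (isOpen_Ioo.prod (isOpen_target p))
    (h.contDiffOn_coordFamily p) (z := (t, z)) ⟨ht, hz⟩
  have e := covD_eq_timeCovD (G := g.coord p) hF
  rw [energyDensity_eq_energyPairing, g.energyPairing_eq hz hW hW, timeEnergy, ← e]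
  rfl

/-- For a fixed point all W_t lie in one tangent space, so the time derivative commutes with the
linear map `frame`. -/
theorem coordField_variationField (h : g.IsVariation r V D ε W) {p : M}
    {z : EuclideanSpace ℝ (Fin m)} (hz : z ∈ (extChartAt (𝓡 m) p).target) :
    coordField p (variationField W) z = fderiv ℝ (coordFamily p W) (0, z) (1, 0) := by
  have hF := hasDerivAt_prodMk_left (differentiableAt_of_mem (isOpen_Ioo.prod (isOpen_target p))
    (h.contDiffOn_coordFamily p) (z := (0, z)) ⟨h.zero_mem, hz⟩)
  let L : EuclideanSpace ℝ (Fin m) →L[ℝ] EuclideanSpace ℝ (Fin m) := frame p z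
  let c : ℝ → EuclideanSpace ℝ (Fin m) := fun t ↦ W t ((extChartAt (𝓡 m) p).symm z)
  have h1 : HasDerivAt c (L (fderiv ℝ (coordFamily p W) (0, z) (1, 0))) 0 := by
    have h2 := L.hasFDerivAt.comp_hasDerivAt (0 : ℝ) hF
    refine h2.congr_of_eventuallyEq (Filter.Eventually.of_forall fun t ↦ ?_)
    exact (frame_coordField hz (W t)).symm
  have h3 : variationField W ((extChartAt (𝓡 m) p).symm z) =
      frame p z (fderiv ℝ (coordFamily p W) (0, z) (1, 0)) := h1.deriv
  rw [coordField, h3, coframe_frame hz]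

theorem smooth_variationField (h : g.IsVariation r V D ε W) :
    SmoothVField (variationField W) := by
  intro x
  obtain ⟨p, z, hz, rfl⟩ := exists_eq_symm (m := m) x
  refine (smoothVFieldAt_iff hz _).2 ?_
  have hO := (isOpen_Ioo (a := -ε) (b := ε)).prod (isOpen_target (m := m) p)
  have h1 : ContDiffAt ℝ ∞ (fderiv ℝ (coordFamily p W)) (0, z) :=
    contDiffAt_of_mem hO ((h.contDiffOn_coordFamily p).fderiv_of_isOpen hO (by simp))
      ⟨h.zero_mem, hz⟩
  have h2 : ContDiffAt ℝ ∞ (fun y ↦ fderiv ℝ (coordFamily p W) (0, y) (1, 0)) z :=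
    (h1.comp (f := fun y ↦ ((0 : ℝ), y)) z (contDiffAt_const.prodMk contDiffAt_id)).clm_apply
      contDiffAt_const
  refine h2.congr_of_eventuallyEq ?_
  filter_upwards [(isOpen_target p).mem_nhds hz] with w hw
  exact h.coordField_variationField hw

theorem variationField_eq_zero (h : g.IsVariation r V D ε W) {K : Set M}
    (hK : ∀ t ∈ Set.Ioo (-ε) ε, ∀ x ∉ K, W t x = V x) {x : M} (hx : x ∉ K) :
    variationField W x = 0 := by
  let c : ℝ → EuclideanSpace ℝ (Fin m) := fun t ↦ W t x
  let v : EuclideanSpace ℝ (Fin m) := V x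
  have : c =ᶠ[𝓝 0] fun _ ↦ v := by
    filter_upwards [isOpen_Ioo.mem_nhds h.zero_mem] with t ht using hK t ht x hx
  exact this.deriv_eq.trans (deriv_const _ _)

/-- The derivative at t = 0 of the constant g(W_t, W_t) = r. -/
theorem variationField_orthogonal (h : g.IsVariation r V D ε W) (x : M) :
    g.val x (variationField W x) (V x) = 0 := by
  obtain ⟨p, z, hz, rfl⟩ := exists_eq_symm (m := m) x
  have hF := hasDerivAt_prodMk_left (differentiableAt_of_mem (isOpen_Ioo.prod (isOpen_target p))
    (h.contDiffOn_coordFamily p) (z := (0, z)) ⟨h.zero_mem, hz⟩)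
  have h1 := ((g.coord p z).hasFDerivAt.comp_hasDerivAt (0 : ℝ) hF).clm_apply hF
  have h2 : HasDerivAt (fun t ↦ g.coord p z (coordFamily p W (t, z)) (coordFamily p W (t, z)))
      0 0 := by
    refine (hasDerivAt_const (0 : ℝ) r).congr_of_eventuallyEq ?_
    filter_upwards [isOpen_Ioo.mem_nhds h.zero_mem] with t ht
    exact (g.coord_coframe hz _ _).trans ((h.mem t ht).2 _)
  have e := h1.unique h2
  rw [← h.coordField_variationField hz] at e
  have e0 : coordFamily p W (0, z) = coordField p V z := by rw [coordFamily, h.zero]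
  simp only [Function.comp_apply, e0, (g.isLocalMetric p).symm z hz (coordField p V z)] at e
  rw [coordField, coordField, g.coord_coframe hz] at e
  linarith

theorem hasDerivAt_energyDensity_zero (h : g.IsVariation r V D ε W) (x : M) :
    HasDerivAt (fun t ↦ g.energyDensity (W t) x) (g.energyPairing V (variationField W) x) 0 := by
  obtain ⟨p, z, hz, rfl⟩ := exists_eq_symm (m := m) x
  have hV : SmoothVField V := h.zero ▸ (h.mem 0 h.zero_mem).1
  have h1 := (g.isLocalMetric p).hasDerivAt_timeEnergy (stdBasis m) isOpen_Ioo
    (h.contDiffOn_coordFamily p) h.zero_mem hz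
  have e1 : (fun y ↦ coordFamily p W (0, y)) = coordField p V := by
    funext y; rw [coordFamily, h.zero]
  have e2 : covD (g.coord p) (fun y ↦ fderiv ℝ (coordFamily p W) (0, y) (1, 0)) z =
      covD (g.coord p) (coordField p (variationField W)) z := by
    refine covD_congr ?_
    filter_upwards [(isOpen_target p).mem_nhds hz] with w hw
    exact (h.coordField_variationField hw).symm
  rw [e1, e2, ← g.energyPairing_eq hz (hV.smoothVFieldAt _)
    (h.smooth_variationField.smoothVFieldAt _)] at h1
  have h2 := (h1.const_add (m : ℝ)).const_mul (1 / 2 : ℝ)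
  rw [← mul_assoc, one_div, inv_mul_cancel₀ two_ne_zero, one_mul] at h2
  refine h2.congr_of_eventuallyEq ?_
  filter_upwards [isOpen_Ioo.mem_nhds h.zero_mem] with t ht
  rw [h.energyDensity_eq ht hz, one_div]

theorem contDiffOn_energyDensity (h : g.IsVariation r V D ε W) (p : M) :
    ContDiffOn ℝ ∞ (fun w : ℝ × EuclideanSpace ℝ (Fin m) ↦
      g.energyDensity (W w.1) ((extChartAt (𝓡 m) p).symm w.2))
      (Set.Ioo (-ε) ε ×ˢ (extChartAt (𝓡 m) p).target) := by
  have h1 := (g.isLocalMetric p).contDiffOn_timeEnergy (stdBasis m) isOpen_Ioo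
    (h.contDiffOn_coordFamily p)
  exact ((contDiffOn_const (c := (1 / 2 : ℝ))).mul ((contDiffOn_const (c := (m : ℝ))).add h1)).congr
    fun w hw ↦ h.energyDensity_eq hw.1 hw.2

theorem hasDerivAt_energyDensity (h : g.IsVariation r V D ε W) {t : ℝ}
    (ht : t ∈ Set.Ioo (-ε) ε) (x : M) : HasDerivAt (fun s ↦ g.energyDensity (W s) x)
      (deriv (fun s ↦ g.energyDensity (W s) x) t) t := by
  obtain ⟨p, z, hz, rfl⟩ := exists_eq_symm (m := m) x
  exact (hasDerivAt_prodMk_left (differentiableAt_of_mem (isOpen_Ioo.prod (isOpen_target p))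
    (h.contDiffOn_energyDensity p) (z := (t, z)) ⟨ht, hz⟩)).differentiableAt.hasDerivAt

theorem continuousOn_deriv_energyDensity (h : g.IsVariation r V D ε W) :
    ContinuousOn (fun q : ℝ × M ↦ deriv (fun s ↦ g.energyDensity (W s) q.2) q.1)
      (Set.Ioo (-ε) ε ×ˢ Set.univ) := by
  rintro ⟨t, x⟩ ⟨ht, -⟩
  refine ContinuousAt.continuousWithinAt ?_
  have hO := (isOpen_Ioo (a := -ε) (b := ε)).prod (isOpen_target (m := m) x)
  have h1 := h.contDiffOn_energyDensity x
  have h2 := (contDiffAt_of_mem hO (h1.fderiv_of_isOpen hO (m := ∞) (by simp))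
    (z := (t, extChartAt (𝓡 m) x x)) ⟨ht, mem_extChartAt_target x⟩).continuousAt
  have h3 : ContinuousAt (fun q : ℝ × M ↦ (q.1, extChartAt (𝓡 m) x q.2)) (t, x) :=
    continuousAt_fst.prodMk (ContinuousAt.comp (f := Prod.snd) (x := (t, x))
      (continuousAt_extChartAt (I := 𝓡 m) x) continuousAt_snd)
  have h4 := (ContinuousAt.comp (f := fun q : ℝ × M ↦ (q.1, extChartAt (𝓡 m) x q.2)) (x := (t, x))
    h2 h3).clm_apply (continuousAt_const (y := ((1 : ℝ), (0 : EuclideanSpace ℝ (Fin m)))))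
  refine h4.congr ?_
  have hn : Set.Ioo (-ε) ε ×ˢ (extChartAt (𝓡 m) x).source ∈ 𝓝 (t, x) :=
    (isOpen_Ioo.prod (isOpen_extChartAt_source x)).mem_nhds ⟨ht, mem_extChartAt_source x⟩
  filter_upwards [hn] with q hq
  have h5 : deriv (fun s ↦ g.energyDensity (W s)
      ((extChartAt (𝓡 m) x).symm (extChartAt (𝓡 m) x q.2))) q.1 = _ :=
    (hasDerivAt_prodMk_left (differentiableAt_of_mem hO h1
    (z := (q.1, extChartAt (𝓡 m) x q.2)) ⟨hq.1, (extChartAt (𝓡 m) x).map_source hq.2⟩)).deriv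
  rw [(extChartAt (𝓡 m) x).left_inv hq.2] at h5
  exact h5.symm

variable [T2Space M] [SecondCountableTopology M] [MeasurableSpace M] [BorelSpace M]

/-- The first variation of the energy. -/
theorem hasDerivAt_energy (h : g.IsVariation r V D ε W) (hD : IsOpen D)
    (hDc : IsCompact (closure D)) :
    HasDerivAt (fun t ↦ g.energy D (W t))
      (∫ x, g.energyPairing V (variationField W) x ∂g.volumeMeasure) 0 := by
  have := g.isLocallyFiniteMeasure_volumeMeasure
  have hε := h.pos
  have hV : SmoothVField V := h.zero ▸ (h.mem 0 h.zero_mem).1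
  -- Halving ε gives a compact time interval, on whose product with the closure of D the time
  -- derivative is bounded; this constant is the dominating function.
  have hsub : Set.Icc (-(ε / 2)) (ε / 2) ⊆ Set.Ioo (-ε) ε := fun t ht ↦
    ⟨by linarith [ht.1], by linarith [ht.2]⟩
  have hcont : ∀ t ∈ Set.Ioo (-ε) ε, Continuous (g.energyDensity (W t)) := fun t ht ↦ by
    have e : g.energyDensity (W t) = fun x ↦ 1 / 2 * (m + g.energyPairing (W t) (W t) x) :=
      funext fun x ↦ g.energyDensity_eq_energyPairing _ x
    rw [e]
    exact continuous_const.mul (continuous_const.add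
      (g.continuous_energyPairing (h.mem t ht).1 (h.mem t ht).1))
  obtain ⟨C, hC⟩ := (isCompact_Icc.prod hDc).exists_bound_of_continuousOn
    (h.continuousOn_deriv_energyDensity.mono (Set.prod_mono hsub (Set.subset_univ (closure D))))
  have hfin : g.volumeMeasure D < ⊤ := (measure_mono subset_closure).trans_lt hDc.measure_lt_top
  have hzero : ∀ x, deriv (fun s ↦ g.energyDensity (W s) x) 0 =
      g.energyPairing V (variationField W) x := fun x ↦ (h.hasDerivAt_energyDensity_zero x).deriv
  have key := (hasDerivAt_integral_of_dominated_loc_of_deriv_le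
    (μ := g.volumeMeasure.restrict D) (F := fun t x ↦ g.energyDensity (W t) x)
    (F' := fun t x ↦ deriv (fun s ↦ g.energyDensity (W s) x) t) (x₀ := (0 : ℝ))
    (s := Set.Ioo (-(ε / 2)) (ε / 2)) (bound := fun _ ↦ C)
    (isOpen_Ioo.mem_nhds ⟨by linarith, by linarith⟩) ?_ ?_ ?_ ?_ ?_ ?_).2
  · obtain ⟨K, hK, hKD, hWK⟩ := h.support
    simp only [hzero] at key
    -- The variation field vanishes off K ⊆ D, so the integral over D is the integral over M.
    rwa [setIntegral_eq_integral_of_forall_compl_eq_zero fun x hx ↦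
      g.energyPairing_eq_zero_of_notMem hV h.smooth_variationField hK
        (fun x hx ↦ h.variationField_eq_zero hWK hx) fun hxK ↦ hx (hKD hxK)] at key
  · filter_upwards [isOpen_Ioo.mem_nhds h.zero_mem] with t ht
    exact (hcont t ht).aestronglyMeasurable
  · exact ((hcont 0 h.zero_mem).continuousOn.integrableOn_compact hDc).mono_set subset_closure
  · simp only [hzero]
    exact (g.continuous_energyPairing hV h.smooth_variationField).aestronglyMeasurable
  · refine (ae_restrict_iff' hD.measurableSet).2 (Filter.Eventually.of_forall fun x hx t ht ↦ ?_)
    exact hC (t, x) ⟨Set.Ioo_subset_Icc_self ht, subset_closure hx⟩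
  · exact integrableOn_const hfin.ne
  · exact Filter.Eventually.of_forall fun x t ht ↦
      h.hasDerivAt_energyDensity (hsub (Set.Ioo_subset_Icc_self ht)) x

end SemiRiemannianMetric.IsVariation

end Variation

end Paracontact
end

theorem corollary3p3 {n : ℕ} {M : Type*} [TopologicalSpace M] [T2Space M]
    [SecondCountableTopology M] [ConnectedSpace M]
    [ChartedSpace (EuclideanSpace ℝ (Fin (2 * n + 1))) M] [IsManifold (𝓡 (2 * n + 1)) ∞ M]
    [MeasurableSpace M] [BorelSpace M]
    (S : Paracontact.ParacontactMetricStructure n M) (hS : S.IsEtaEinstein) :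
    S.IsHParacontact := by
  refine ⟨1, one_ne_zero, ⟨S.smooth_ξ, S.g_ξ_ξ⟩, fun D hD hDc ε W hW ↦ ?_⟩
  obtain ⟨K, hK, -, hWK⟩ := hW.support
  have h := hW.hasDerivAt_energy hD hDc
  -- The variation field is smooth, orthogonal to ξ and zero off the compact set K, so the first
  -- variation integral vanishes.
  rwa [hS.integral_energyPairing_eq_zero hW.smooth_variationField hW.variationField_orthogonal hK
    fun x hx ↦ hW.variationField_eq_zero hWK hx] at h
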